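/- **Setting.** Let $A\in\mathbb R^{n\times n}$, $B\in\mathbb R^{n\times m}$ with $(A,B)$ stabilizable, and let $Q\in\mathbb R^{n\times n}$, $R\in\mathbb R^{m\times m}$ be symmetric positive definite. Let $X\succeq 0$ solve the Riccati equation $X=Q+A^\top XA-A^\top XB(R+B^\top XB)^{-1}B^\top XA$, and put $K=(R+B^\top XB)^{-1}B^\top XA$, $K_i=(R+B^\top XB)^{-1}B^\top\big((A-BK)^{\top}\big)^{i}X$ for $i\ge 0$, and $\rho=\sqrt{1-\lambda_{\min}(Q)/\lambda_{\max}(X)}$; assume $\rho\in(0,1)$ ($\rho<1$ always holds, and $\rho=0$ only if $A=0$ and $Q$ is a multiple of the identity). For a target $(r_t)$ and a system $x_{t+1}=Ax_t+Bu_t$ with initial state $x_0$, the cost over the horizon $T$ is $$J_T(u)=\sum_{t=0}^{T-1}\big(\|x_t-r_t\|_Q^2+\|u_t\|_R^2\big)+\|x_T-r_T\|_X^2 ,$$ and the dynamic regret of an input sequence $u$ is $J_T(u)-\inf_v J_T(v)$. Fix $p\ge 1$, $M>0$, $D_r$, $\varepsilon>0$ and let $\mathcal S=\{S\in\mathbb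 R^{n\times np}:\|S\|\le M\}$ (spectral norm). The target satisfies $\|r_t\|\le D_r$ for all $t\le T$ and $r_{t+1}=S_{t+1}z_t$ for $0\le t<T$, where $z_t=(r_t^\top,\dots,r_{t-p+1}^\top)^\top$. Here $S_0\in\mathcal S$, and the $k$-step ahead dynamics $S_{t+k|t}$ lie in $\mathcal S$ for all $t\ge 0$, $k\ge1$, $t+k\le T$; $S_{t+k|t}$ is the first block row of $\mathcal A_{t+k}\cdots\mathcal A_{t+1}$, where $\mathcal A_s$ is the block companion matrix with first block row $S_s$ (so $r_{t+k}=S_{t+k|t}z_t$). Let $V_T=\sum_{t=0}^{T-1}\|S_{t+1}-S_t\|_F$. **PLOT** with prediction horizon $W$, forgetting factor $\gamma$ and regularization $\varepsilon$. For each $k=1,\dots,W$ and $-1\le j\le k-2$ initialize $P_{j|j-k}=\varepsilon I$ and $\hat S_{j+k|j}\in\mathcal S$ arbitrarily; for $k-1\le t<T$ update $$P_{t|t-k}=\gamma P_{t-k|t-2k}+z_{t-k}z_{t-k}^\top,\qquad \hat S_{t+k|t}=\Pi_{\mathcal S}^{P_{t|t-k}}\big(\hat S_{t|t-k}+(r_t-\hat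 S_{t|t-k}z_{t-k})z_{t-k}^\top P_{t|t-k}^{-1}\big),$$ where $\Pi^P_{\mathcal S}(Y)$ minimizes $\mathrm{tr}\big((S-Y)P(S-Y)^\top\big)$ over $S\in\mathcal S$. With $r_{t|t}=r_t$ and $r_{t+k|t}=\hat S_{t+k|t}z_t$ for $t+k\le T$, at each time $t=0,\dots,T-1$ apply $$u_t=-K(x_t-r_t)-\sum_{i=t}^{\min\{t+W-1,\,T-1\}}K_{i-t}\,(Ar_{i|t}-r_{i+1|t}).$$ (The result is the same if the upper limit is $\min\{t+W-1,T\}$ with $r_{T+1|t}=0$.) **Claim.** There is a constant $C$, depending only on $n,m,p,A,B,Q,R,M,D_r,\varepsilon$, such that for all $T\ge 2$, every target as above, every initial state $x_0$ and every initialization of the learners, if $W\ge 0$ is an integer with $\big|W+\frac{\log T}{2\log\rho}\big|<1$ (that is, $-\log T/(2\log\rho)$ rounded up or down) and $$\gamma=1-\sqrt{\frac{\max\{V_T,\ \log^2T/T\}}{4MT}},$$ then the dynamic regret of PLOT is at most $C\max\{\sqrt{TV_T},\ \log T\}$. In particular, it is at most $C\log T$ when the target dynamics are fixed ($V_T=0$).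 (One always has $\gamma<1$. In the exceptional cases where this formula gives $\gamma\le 0$, the claim holds for any minimizer in the projection, with a singular $P_{t|t-k}^{-1}$ read as $0$.) -/

import Mathlib

open scoped Matrix

noncomputable section

namespace PLOT

/-! ### Norms and eigenvalues -/

open scoped Matrix.Norms.L2Operator in
/-- The spectral norm, i.e. the operator norm induced by the Euclidean norms. -/
def specNorm {α β : Type} [Fintype α] [Fintype β] [DecidableEq β]
    (S : Matrix α β ℝ) : ℝ := ‖S‖

/-- The squared weighted Frobenius norm `‖S‖²_{F,P} = tr (S P Sᵀ)`. -/
def wFrobSq {α β : Type} [Fintype α] [Fintype β] (P : Matrix β β ℝ) (S : Matrix α β ℝ) : ℝ :=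
  (S * P * Sᵀ).trace

/-- The Frobenius norm. -/
def frobNorm {α β : Type} [Fintype α] [Fintype β] (S : Matrix α β ℝ) : ℝ :=
  Real.sqrt ((S * Sᵀ).trace)

/-- The Euclidean norm of a vector given by its coordinates. -/
def euclNorm {α : Type} [Fintype α] (v : α → ℝ) : ℝ := ‖WithLp.toLp 2 v‖

/-- Smallest eigenvalue of a symmetric matrix. -/
def minEig {α : Type} [Fintype α] [DecidableEq α] (Q : Matrix α α ℝ) : ℝ := sInf (spectrum ℝ Q)

/-- Largest eigenvalue of a symmetric matrix. -/
def maxEig {α : Type} [Fintype α] [DecidableEq α] (Q : Matrix α α ℝ) : ℝ := sSup (spectrum ℝ Q)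

/-! ### The linear quadratic tracking problem -/

section Control

variable {n m : ℕ}

/-- `(A, B)` is stabilizable: for some feedback gain all (complex) eigenvalues of `A - B K₀` lie
strictly inside the unit circle. -/
def IsStabilizable (A : Matrix (Fin n) (Fin n) ℝ) (B : Matrix (Fin n) (Fin m) ℝ) : Prop :=
  ∃ K₀ : Matrix (Fin m) (Fin n) ℝ,
    ∀ μ ∈ spectrum ℂ ((A - B * K₀).map (algebraMap ℝ ℂ)), ‖μ‖ < 1

/-- `X` is the positive semidefinite solution of the discrete algebraic Riccati equation
`X = Q + Aᵀ X A - Aᵀ X B (R + Bᵀ X B)⁻¹ Bᵀ X A`. -/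
def IsRiccatiSolution (A : Matrix (Fin n) (Fin n) ℝ) (B : Matrix (Fin n) (Fin m) ℝ)
    (Q : Matrix (Fin n) (Fin n) ℝ) (R : Matrix (Fin m) (Fin m) ℝ)
    (X : Matrix (Fin n) (Fin n) ℝ) : Prop :=
  X.PosSemidef ∧ X = Q + Aᵀ * X * A - Aᵀ * X * B * (R + Bᵀ * X * B)⁻¹ * (Bᵀ * X * A)

/-- The optimal feedback gain `K = (R + Bᵀ X B)⁻¹ Bᵀ X A`. -/
def fbGain (A : Matrix (Fin n) (Fin n) ℝ) (B : Matrix (Fin n) (Fin m) ℝ)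
    (R : Matrix (Fin m) (Fin m) ℝ) (X : Matrix (Fin n) (Fin n) ℝ) : Matrix (Fin m) (Fin n) ℝ :=
  (R + Bᵀ * X * B)⁻¹ * (Bᵀ * X * A)

/-- The feedforward gains `K_i = (R + Bᵀ X B)⁻¹ Bᵀ ((A - B K)ᵀ) ^ i X`. -/
def ffGain (A : Matrix (Fin n) (Fin n) ℝ) (B : Matrix (Fin n) (Fin m) ℝ)
    (R : Matrix (Fin m) (Fin m) ℝ) (X : Matrix (Fin n) (Fin n) ℝ) (i : ℕ) :
    Matrix (Fin m) (Fin n) ℝ :=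
  (R + Bᵀ * X * B)⁻¹ * Bᵀ * ((A - B * fbGain A B R X)ᵀ) ^ i * X

/-- The decay rate `ρ = √(1 - λ_min(Q) / λ_max(X))`. -/
def decayRate (Q X : Matrix (Fin n) (Fin n) ℝ) : ℝ := Real.sqrt (1 - minEig Q / maxEig X)

/-- State trajectory of `x_{t+1} = A x_t + B u_t` started at `x₀`. -/
def stateTraj (A : Matrix (Fin n) (Fin n) ℝ) (B : Matrix (Fin n) (Fin m) ℝ)
    (x₀ : Fin n → ℝ) (u : ℕ → Fin m → ℝ) : ℕ → Fin n → ℝ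
  | 0 => x₀
  | t + 1 => A *ᵥ stateTraj A B x₀ u t + B *ᵥ u t

/-- The tracking cost
`∑_{t<T} (‖x_t - r_t‖²_Q + ‖u_t‖²_R) + ‖x_T - r_T‖²_X`. -/
def lqtCost (A : Matrix (Fin n) (Fin n) ℝ) (B : Matrix (Fin n) (Fin m) ℝ)
    (Q : Matrix (Fin n) (Fin n) ℝ) (R : Matrix (Fin m) (Fin m) ℝ)
    (X : Matrix (Fin n) (Fin n) ℝ) (T : ℕ) (r : ℤ → Fin n → ℝ) (x₀ : Fin n → ℝ)
    (u : ℕ → Fin m → ℝ) : ℝ :=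
  (∑ t ∈ Finset.range T,
      ((stateTraj A B x₀ u t - r t) ⬝ᵥ Q *ᵥ (stateTraj A B x₀ u t - r t)
        + u t ⬝ᵥ R *ᵥ u t))
    + (stateTraj A B x₀ u T - r T) ⬝ᵥ X *ᵥ (stateTraj A B x₀ u T - r T)

/-- Dynamic regret of the inputs `u`: their cost minus the least cost attainable in hindsight, that
is by input sequences chosen with full knowledge of the target. -/
def dynamicRegret (A : Matrix (Fin n) (Fin n) ℝ) (B : Matrix (Fin n) (Fin m) ℝ)
    (Q : Matrix (Fin n) (Fin n) ℝ) (R : Matrix (Fin m) (Fin m) ℝ)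
    (X : Matrix (Fin n) (Fin n) ℝ) (T : ℕ) (r : ℤ → Fin n → ℝ) (x₀ : Fin n → ℝ)
    (u : ℕ → Fin m → ℝ) : ℝ :=
  lqtCost A B Q R X T r x₀ u - ⨅ v : ℕ → Fin m → ℝ, lqtCost A B Q R X T r x₀ v

end Control

/-! ### Autoregressive targets -/

section Target

variable {n p : ℕ}

/-- The regressor `z_t = (r_t, r_{t-1}, …, r_{t-p+1})`. -/
def regressor (p : ℕ) (r : ℤ → Fin n → ℝ) (t : ℤ) : Fin p × Fin n → ℝ :=
  fun a => r (t - (a.1 : ℕ)) a.2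

/-- The block companion matrix with `S` as first block row and identity blocks below it. -/
def companion (S : Matrix (Fin n) (Fin p × Fin n) ℝ) :
    Matrix (Fin p × Fin n) (Fin p × Fin n) ℝ :=
  Matrix.of fun a b =>
    if (a.1 : ℕ) = 0 then S a.2 b
    else if (a.1 : ℕ) = (b.1 : ℕ) + 1 ∧ a.2 = b.2 then 1 else 0

/-- The transition matrix `Φ_{t+k|t} = 𝒜_{t+k} ⋯ 𝒜_{t+1}`. -/
def transition (S : ℕ → Matrix (Fin n) (Fin p × Fin n) ℝ) (t : ℕ) :
    ℕ → Matrix (Fin p × Fin n) (Fin p × Fin n) ℝ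
  | 0 => 1
  | k + 1 => companion (S (t + k + 1)) * transition S t k

/-- The output matrix `(I_n, 0, …, 0)`. -/
def outputMatrix (n p : ℕ) : Matrix (Fin n) (Fin p × Fin n) ℝ :=
  Matrix.of fun i b => if (b.1 : ℕ) = 0 ∧ i = b.2 then 1 else 0

/-- The `k`-step ahead target dynamics `S_{t+k|t}`, i.e. the first block row of `Φ_{t+k|t}`. -/
def multiStep (S : ℕ → Matrix (Fin n) (Fin p × Fin n) ℝ) (t k : ℕ) :
    Matrix (Fin n) (Fin p × Fin n) ℝ :=
  outputMatrix n p * transition S t k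

/-- The constraint set `𝒮` of matrices of spectral norm at most `M`. -/
def boundedSet (n p : ℕ) (M : ℝ) : Set (Matrix (Fin n) (Fin p × Fin n) ℝ) :=
  {S | specNorm S ≤ M}

/-- The target `r` (with its past, `t < 0`, known) over the horizon `T` is bounded by `D` and follows
the autoregressive dynamics `r_{t+1} = S_{t+1} z_t`, where the one-step and multi-step ahead
dynamics all lie in `𝒮`. -/
structure IsTarget (T : ℕ) (M D : ℝ) (r : ℤ → Fin n → ℝ)
    (S : ℕ → Matrix (Fin n) (Fin p × Fin n) ℝ) : Prop where
  bounded : ∀ t : ℤ, t ≤ T → euclNorm (r t) ≤ D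
  dynamics : ∀ t : ℕ, t < T → r (t + 1) = S (t + 1) *ᵥ regressor p r t
  init_mem : S 0 ∈ boundedSet n p M
  multiStep_mem : ∀ t k : ℕ, 1 ≤ k → t + k ≤ T → multiStep S t k ∈ boundedSet n p M

/-- Total variation `V_T = ∑_{t<T} ‖S_{t+1} - S_t‖_F` of the target dynamics. -/
def pathLength (T : ℕ) (S : ℕ → Matrix (Fin n) (Fin p × Fin n) ℝ) : ℝ :=
  ∑ t ∈ Finset.range T, frobNorm (S (t + 1) - S t)

end Target

/-! ### The algorithm -/

section Algorithm

variable {n m p : ℕ}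

/-- `S` is a projection of `Y` on the set `𝒮` in the weighted Frobenius norm `‖·‖_{F,P}`. -/
def IsProjection {α β : Type} [Fintype α] [Fintype β] (𝒮 : Set (Matrix α β ℝ))
    (P : Matrix β β ℝ) (Y S : Matrix α β ℝ) : Prop :=
  S ∈ 𝒮 ∧ ∀ S' ∈ 𝒮, wFrobSq P (S - Y) ≤ wFrobSq P (S' - Y)

/-- `Ŝ k t` and `P k t` stand for `Ŝ_{t+k|t}` and `P_{t|t-k}`. They are produced by recursive least
squares with forgetting factor `γ` and regularization `ε`; the `k`-step ahead predictor consists of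
`k` learners updated at non-overlapping times, since `Ŝ_{t+k|t}` is computed from `Ŝ_{t|t-k}`. -/
structure IsRLS (T W : ℕ) (M ε γ : ℝ) (r : ℤ → Fin n → ℝ)
    (Shat : ℕ → ℤ → Matrix (Fin n) (Fin p × Fin n) ℝ)
    (P : ℕ → ℤ → Matrix (Fin p × Fin n) (Fin p × Fin n) ℝ) : Prop where
  init_P : ∀ k : ℕ, 1 ≤ k → k ≤ W → ∀ j : ℤ, -1 ≤ j → j ≤ (k : ℤ) - 2 → P k j = ε • 1
  init_S : ∀ k : ℕ, 1 ≤ k → k ≤ W → ∀ j : ℤ, -1 ≤ j → j ≤ (k : ℤ) - 2 →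
    Shat k j ∈ boundedSet n p M
  update_P : ∀ k : ℕ, 1 ≤ k → k ≤ W → ∀ t : ℤ, (k : ℤ) - 1 ≤ t → t < T →
    P k t = γ • P k (t - k)
      + Matrix.vecMulVec (regressor p r (t - k)) (regressor p r (t - k))
  update_S : ∀ k : ℕ, 1 ≤ k → k ≤ W → ∀ t : ℤ, (k : ℤ) - 1 ≤ t → t < T →
    IsProjection (boundedSet n p M) (P k t)
      (Shat k (t - k)
        + Matrix.vecMulVec (r t - Shat k (t - k) *ᵥ regressor p r (t - k))
            (regressor p r (t - k)) * (P k t)⁻¹)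
      (Shat k t)

/-- The predictions `r_{t+k|t}`: the observed `r_t` for `k = 0`, and `Ŝ_{t+k|t} z_t` for `k ≥ 1`
within the horizon; nothing is predicted (zero) beyond it. -/
def prediction (T : ℕ) (r : ℤ → Fin n → ℝ)
    (Shat : ℕ → ℤ → Matrix (Fin n) (Fin p × Fin n) ℝ) (t k : ℕ) : Fin n → ℝ :=
  if k = 0 then r t
  else if t + k ≤ T then Shat k t *ᵥ regressor p r t
  else 0

/-- The receding horizon control action at time `t` in state `x`:
`-K (x - r_t) - ∑_{i=t}^{min(t+W-1, N)} K_{i-t} (A r_{i|t} - r_{i+1|t})`. -/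
def plotAction (A : Matrix (Fin n) (Fin n) ℝ) (B : Matrix (Fin n) (Fin m) ℝ)
    (R : Matrix (Fin m) (Fin m) ℝ) (X : Matrix (Fin n) (Fin n) ℝ) (T W N : ℕ)
    (r : ℤ → Fin n → ℝ) (Shat : ℕ → ℤ → Matrix (Fin n) (Fin p × Fin n) ℝ)
    (t : ℕ) (x : Fin n → ℝ) : Fin m → ℝ :=
  -(fbGain A B R X *ᵥ (x - r t))
    - ∑ i ∈ (Finset.range W).filter (fun i => t + i ≤ N),
        ffGain A B R X i *ᵥ
          (A *ᵥ prediction T r Shat t i - prediction T r Shat t (i + 1))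

/-- `u` is the input sequence that PLOT applies over the horizon `T` from the initial state `x₀`,
with prediction horizon `W`, forgetting factor `γ` and some initialization of the learners. -/
def IsPLOTInput (A : Matrix (Fin n) (Fin n) ℝ) (B : Matrix (Fin n) (Fin m) ℝ)
    (R : Matrix (Fin m) (Fin m) ℝ) (X : Matrix (Fin n) (Fin n) ℝ) (p T W N : ℕ) (M ε γ : ℝ)
    (r : ℤ → Fin n → ℝ) (x₀ : Fin n → ℝ) (u : ℕ → Fin m → ℝ) : Prop :=
  ∃ (Shat : ℕ → ℤ → Matrix (Fin n) (Fin p × Fin n) ℝ)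
    (P : ℕ → ℤ → Matrix (Fin p × Fin n) (Fin p × Fin n) ℝ),
    IsRLS T W M ε γ r Shat P ∧
    ∀ t : ℕ, t < T → u t = plotAction A B R X T W N r Shat t (stateTraj A B x₀ u t)

/-- The forgetting factor `γ = 1 - √(max{V, log² T / T} / (4 M T))`. -/
def forgettingFactor (M : ℝ) (T : ℕ) (V : ℝ) : ℝ :=
  1 - Real.sqrt (max V (Real.log T ^ 2 / T) / (4 * M * T))

end Algorithm

end PLOT

end

/-! Completing the square along the Riccati recursion writes the cost of any input as a constant,
depending only on the target and the initial state, plus the sum of the squared deviations `u_t -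
u*_t(x_t)` in the weight `R + Bᵀ X B` (`lqtCost_eq`). Here `u*_t` is the optimal feedback for a
known target, evaluated at the state actually visited. Regret is thus controlled by the distance
between PLOT and this oracle in the same state (`dynamicRegret_le`).

The feedback parts cancel in that distance. What remains is the feedforward gains applied to
multi-step prediction errors, a tail beyond the horizon `W`, and at most one boundary term
(`euclNorm_plotAction_sub_le`). Since `v ⬝ᵥ X *ᵥ v` shrinks by `ρ²` per closed-loop step, the gains
decay like `ρ ^ i`. The tail then costs a multiple of `T ρ ^ (2W)`, which the choice of `W` keeps
bounded.

The `k`-step predictor consists of `k` interleaved least squares learners. Each update pays for its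
squared error with a decrease of a weighted distance to the true dynamics, up to a leverage term
(`rls_step`). Leverages sum by a log-determinant argument (`leverage_le_log_det`); motion of the
true dynamics costs at most the size of `P` times their variation, and `k`-step dynamics vary by
`O(k² V)` (`sum_frobNorm_multiStep_sub_le`). The cumulative error is `O(k² (V / (1 - γ) + T (1 - γ)
+ log (1 / (1 - γ)) + 1))`. The prescribed `γ` makes `T (1 - γ)` proportional to `G = max {√(T V),
log T}`, which balances the terms to `O(k² G)`; if `γ < 1/2`, then `T = O(G)` and boundedness of the
errors suffices.

Finally, Cauchy–Schwarz with weights `ρ ^ i` and convergence of `∑ ρ ^ i (i + 1)²` sum the errors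
over all horizons with a constant independent of `W`. -/

open scoped Matrix

noncomputable section

namespace PLOT

/-! ### Euclidean, spectral and Frobenius norms -/

section Basics

variable {α β : Type} [Fintype α] [Fintype β]

theorem euclNorm_nonneg (v : α → ℝ) : 0 ≤ euclNorm v := norm_nonneg _

theorem euclNorm_sq (v : α → ℝ) : euclNorm v ^ 2 = v ⬝ᵥ v := by
  rw [euclNorm, EuclideanSpace.real_norm_sq_eq]
  simp [dotProduct, sq]

theorem dotProduct_self_nonneg' (v : α → ℝ) : 0 ≤ v ⬝ᵥ v := by
  rw [← euclNorm_sq]; positivity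

theorem euclNorm_zero : euclNorm (0 : α → ℝ) = 0 := by simp [euclNorm]

theorem euclNorm_add_le (v w : α → ℝ) : euclNorm (v + w) ≤ euclNorm v + euclNorm w := by
  simpa [euclNorm] using norm_add_le (WithLp.toLp 2 v) (WithLp.toLp 2 w)

theorem euclNorm_sub_le (v w : α → ℝ) : euclNorm (v - w) ≤ euclNorm v + euclNorm w := by
  simpa [euclNorm] using norm_sub_le (WithLp.toLp 2 v) (WithLp.toLp 2 w)

theorem euclNorm_sub_comm (v w : α → ℝ) : euclNorm (v - w) = euclNorm (w - v) := by
  simpa [euclNorm] using norm_sub_rev (WithLp.toLp 2 v) (WithLp.toLp 2 w)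

theorem euclNorm_sum_le {ι : Type*} (s : Finset ι) (f : ι → α → ℝ) :
    euclNorm (∑ i ∈ s, f i) ≤ ∑ i ∈ s, euclNorm (f i) := by
  classical
  induction s using Finset.induction_on with
  | empty => simp [euclNorm_zero]
  | insert a s ha ih =>
    rw [Finset.sum_insert ha, Finset.sum_insert ha]
    exact (euclNorm_add_le _ _).trans (by linarith)

section SpecNorm

variable [DecidableEq β]

open scoped Matrix.Norms.L2Operator in
theorem specNorm_nonneg (S : Matrix α β ℝ) : 0 ≤ specNorm S := norm_nonneg S

open scoped Matrix.Norms.L2Operator in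
theorem euclNorm_mulVec_le (S : Matrix α β ℝ) (v : β → ℝ) :
    euclNorm (S *ᵥ v) ≤ specNorm S * euclNorm v :=
  Matrix.l2_opNorm_mulVec S (WithLp.toLp 2 v)

open scoped Matrix.Norms.L2Operator in
theorem specNorm_le_of_forall {S : Matrix α β ℝ} {c : ℝ} (hc : 0 ≤ c)
    (h : ∀ v, euclNorm (S *ᵥ v) ≤ c * euclNorm v) : specNorm S ≤ c := by
  rw [specNorm, Matrix.l2_opNorm_def]
  exact ContinuousLinearMap.opNorm_le_bound _ hc fun v => h v.ofLp

open scoped Matrix.Norms.L2Operator in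
theorem specNorm_mul_le {δ : Type} [Fintype δ] [DecidableEq δ] (S : Matrix α β ℝ)
    (S' : Matrix β δ ℝ) : specNorm (S * S') ≤ specNorm S * specNorm S' :=
  Matrix.l2_opNorm_mul S S'

open scoped Matrix.Norms.L2Operator in
theorem specNorm_transpose [DecidableEq α] (S : Matrix α β ℝ) : specNorm Sᵀ = specNorm S := by
  have h := Matrix.l2_opNorm_conjTranspose S
  rwa [Matrix.conjTranspose_eq_transpose_of_trivial] at h

/-- Apply `S` to its own row: coordinate `i` of the image is the squared length `q` of the row, so
`q² ≤ M² q`. -/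
theorem dotProduct_row_self_le {S : Matrix α β ℝ} {M : ℝ} (hS : specNorm S ≤ M)
    (i : α) : S i ⬝ᵥ S i ≤ M ^ 2 := by
  have h1 : (S *ᵥ S i) i ^ 2 ≤ euclNorm (S *ᵥ S i) ^ 2 := by
    rw [euclNorm_sq, dotProduct, sq]
    exact Finset.single_le_sum (f := fun j => (S *ᵥ S i) j * (S *ᵥ S i) j)
      (fun j _ => mul_self_nonneg _) (Finset.mem_univ i)
  have h2 : euclNorm (S *ᵥ S i) ^ 2 ≤ M ^ 2 * (S i ⬝ᵥ S i) := by
    rw [← euclNorm_sq (S i), ← mul_pow]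
    exact pow_le_pow_left₀ (euclNorm_nonneg _) ((euclNorm_mulVec_le S _).trans
      (mul_le_mul_of_nonneg_right hS (euclNorm_nonneg _))) 2
  have h3 : (S *ᵥ S i) i = S i ⬝ᵥ S i := rfl
  rw [h3] at h1
  have h0 := dotProduct_self_nonneg' (S i)
  by_contra hlt
  push Not at hlt
  have : 0 < S i ⬝ᵥ S i := lt_of_le_of_lt (sq_nonneg M) hlt
  nlinarith

end SpecNorm

open scoped Matrix.Norms.L2Operator in
theorem convex_boundedSet (n p : ℕ) (M : ℝ) : Convex ℝ (boundedSet n p M) := by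
  intro S hS S' hS' a b ha hb hab
  change ‖S‖ ≤ M at hS
  change ‖S'‖ ≤ M at hS'
  change ‖a • S + b • S'‖ ≤ M
  calc ‖a • S + b • S'‖ ≤ ‖a • S‖ + ‖b • S'‖ := norm_add_le _ _
    _ = a * ‖S‖ + b * ‖S'‖ := by
      rw [norm_smul, norm_smul, Real.norm_of_nonneg ha, Real.norm_of_nonneg hb]
    _ ≤ a * M + b * M := by gcongr
    _ = M := by rw [← add_mul, hab, one_mul]

theorem trace_mul_transpose_self (S : Matrix α β ℝ) : (S * Sᵀ).trace = ∑ i, S i ⬝ᵥ S i := by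
  simp [Matrix.trace, Matrix.mul_apply, dotProduct]

open scoped Matrix.Norms.Frobenius in
theorem frobNorm_eq_norm (S : Matrix α β ℝ) : frobNorm S = ‖S‖ := by
  rw [frobNorm, Matrix.frobenius_norm_def, Real.sqrt_eq_rpow, trace_mul_transpose_self]
  simp [dotProduct, ← sq]

theorem frobNorm_nonneg (S : Matrix α β ℝ) : 0 ≤ frobNorm S := Real.sqrt_nonneg _

theorem frobNorm_sq (S : Matrix α β ℝ) : frobNorm S ^ 2 = ∑ i, S i ⬝ᵥ S i := by
  rw [frobNorm, trace_mul_transpose_self, Real.sq_sqrt]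
  exact Finset.sum_nonneg fun i _ => dotProduct_self_nonneg' _

theorem frobNorm_sum_le {ι : Type*} (s : Finset ι) (f : ι → Matrix α β ℝ) :
    frobNorm (∑ i ∈ s, f i) ≤ ∑ i ∈ s, frobNorm (f i) := by
  simp only [frobNorm_eq_norm]
  open scoped Matrix.Norms.Frobenius in exact norm_sum_le s f

theorem frobNorm_mul_le {δ : Type} [Fintype δ] (S : Matrix α β ℝ) (S' : Matrix β δ ℝ) :
    frobNorm (S * S') ≤ frobNorm S * frobNorm S' := by
  simp only [frobNorm_eq_norm]
  open scoped Matrix.Norms.Frobenius in exact Matrix.frobenius_norm_mul S S'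

/-! ### Eigenvalues and quadratic forms -/

section Eigenvalues

variable [DecidableEq α]

/-- Shifting by `minEig Q` translates the spectrum into the nonnegative half-line, so the shifted
matrix is positive semidefinite. -/
theorem minEig_mul_le {Q : Matrix α α ℝ} (hQ : Q.IsHermitian) (v : α → ℝ) :
    minEig Q * (v ⬝ᵥ v) ≤ v ⬝ᵥ Q *ᵥ v := by
  have hH : (Q - minEig Q • 1).IsHermitian := by
    refine hQ.sub ?_
    rw [Matrix.IsHermitian, Matrix.conjTranspose_smul, Matrix.conjTranspose_one, star_trivial]
  have hP : (Q - minEig Q • 1).PosSemidef := by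
    rw [hH.posSemidef_iff_eigenvalues_nonneg]
    intro i
    have h1 := hH.eigenvalues_mem_spectrum_real i
    have h2 : hH.eigenvalues i + minEig Q ∈ spectrum ℝ Q := by
      generalize hH.eigenvalues i = μ at h1 ⊢
      rw [← Algebra.algebraMap_eq_smul_one, ← spectrum.sub_singleton_eq] at h1
      obtain ⟨x, hx, y, rfl, hxy⟩ := h1
      simpa [← hxy] using hx
    have h3 := csInf_le (Matrix.finite_real_spectrum (A := Q)).bddBelow h2
    change minEig Q ≤ _ at h3
    simpa using h3
  have := hP.dotProduct_mulVec_nonneg v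
  simp only [star_trivial, Matrix.sub_mulVec, Matrix.smul_mulVec, Matrix.one_mulVec,
    dotProduct_sub, dotProduct_smul, smul_eq_mul] at this
  linarith

theorem le_maxEig_mul {Q : Matrix α α ℝ} (hQ : Q.IsHermitian) (v : α → ℝ) :
    v ⬝ᵥ Q *ᵥ v ≤ maxEig Q * (v ⬝ᵥ v) := by
  have h := minEig_mul_le hQ.neg v
  have h2 : minEig (-Q) = - maxEig Q := by
    rw [minEig, maxEig, ← spectrum.neg_eq, Real.sInf_def, neg_neg]
  rw [h2, Matrix.neg_mulVec, dotProduct_neg] at h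
  linarith

theorem minEig_pos [Nonempty α] {Q : Matrix α α ℝ} (hQ : Q.PosDef) : 0 < minEig Q := by
  have hne : (spectrum ℝ Q).Nonempty :=
    ⟨_, hQ.isHermitian.eigenvalues_mem_spectrum_real (Classical.arbitrary α)⟩
  have hmem : minEig Q ∈ spectrum ℝ Q :=
    hne.csInf_mem (Matrix.finite_real_spectrum (A := Q))
  rw [hQ.isHermitian.spectrum_real_eq_range_eigenvalues] at hmem
  obtain ⟨i, hi⟩ := hmem
  rw [← hi]
  exact hQ.eigenvalues_pos i

theorem exists_eigenvector {Q : Matrix α α ℝ} (hQ : Q.IsHermitian) (i : α) :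
    ∃ v : α → ℝ, v ⬝ᵥ v = 1 ∧ v ⬝ᵥ Q *ᵥ v = hQ.eigenvalues i := by
  have h0 : (hQ.eigenvectorBasis i).ofLp ⬝ᵥ (hQ.eigenvectorBasis i).ofLp = 1 := by
    rw [← euclNorm_sq, euclNorm]
    simp
  refine ⟨(hQ.eigenvectorBasis i).ofLp, h0, ?_⟩
  rw [hQ.mulVec_eigenvectorBasis i, dotProduct_smul, h0, smul_eq_mul, mul_one]

theorem det_le_pow {P : Matrix α α ℝ} (hP : P.PosDef) {b : ℝ}
    (h : ∀ v, v ⬝ᵥ P *ᵥ v ≤ b * (v ⬝ᵥ v)) : P.det ≤ b ^ Fintype.card α := by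
  rw [hP.isHermitian.det_eq_prod_eigenvalues]
  calc ∏ i, (hP.isHermitian.eigenvalues i : ℝ) ≤ ∏ _i : α, b := by
        refine Finset.prod_le_prod (fun i _ => (hP.eigenvalues_pos i).le) fun i _ => ?_
        obtain ⟨v, hv, hv'⟩ := exists_eigenvector hP.isHermitian i
        have := h v
        rw [hv, hv', mul_one] at this
        exact this
    _ = b ^ Fintype.card α := by simp

theorem pow_le_det {P : Matrix α α ℝ} (hP : P.PosDef) {b : ℝ} (hb : 0 ≤ b)
    (h : ∀ v, b * (v ⬝ᵥ v) ≤ v ⬝ᵥ P *ᵥ v) : b ^ Fintype.card α ≤ P.det := by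
  rw [hP.isHermitian.det_eq_prod_eigenvalues]
  calc b ^ Fintype.card α = ∏ _i : α, b := by simp
    _ ≤ ∏ i, (hP.isHermitian.eigenvalues i : ℝ) := by
        refine Finset.prod_le_prod (fun i _ => hb) fun i _ => ?_
        obtain ⟨v, hv, hv'⟩ := exists_eigenvector hP.isHermitian i
        have := h v
        rw [hv, hv', mul_one] at this
        exact this

end Eigenvalues

end Basics

/-! ### The regret of a control sequence -/

section Regret

variable {n m : ℕ} {A : Matrix (Fin n) (Fin n) ℝ} {B : Matrix (Fin n) (Fin m) ℝ}
  {Q : Matrix (Fin n) (Fin n) ℝ} {R : Matrix (Fin m) (Fin m) ℝ} {X : Matrix (Fin n) (Fin n) ℝ}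

theorem dotProduct_mulVec_transpose {α β : Type} [Fintype α] [Fintype β] (S : Matrix α β ℝ)
    (v : β → ℝ) (w : α → ℝ) : v ⬝ᵥ Sᵀ *ᵥ w = w ⬝ᵥ S *ᵥ v := by
  rw [Matrix.mulVec_transpose, dotProduct_comm, ← Matrix.dotProduct_mulVec]

theorem dotProduct_mulVec_comm {α : Type} [Fintype α] {S : Matrix α α ℝ} (hS : Sᵀ = S)
    (v w : α → ℝ) : v ⬝ᵥ S *ᵥ w = w ⬝ᵥ S *ᵥ v := by
  rw [← dotProduct_mulVec_transpose, hS]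

/-- The input weight `R + Bᵀ X B` of the completed square. -/
def inputWeight (B : Matrix (Fin n) (Fin m) ℝ) (R : Matrix (Fin m) (Fin m) ℝ)
    (X : Matrix (Fin n) (Fin n) ℝ) : Matrix (Fin m) (Fin m) ℝ := R + Bᵀ * X * B

theorem inputWeight_posDef (hR : R.PosDef) (hX : X.PosSemidef) : (inputWeight B R X).PosDef := by
  refine hR.add_posSemidef ?_
  have := hX.conjTranspose_mul_mul_same B
  rwa [Matrix.conjTranspose_eq_transpose_of_trivial] at this

theorem transpose_eq_of_isHermitian {α : Type} {S : Matrix α α ℝ} (hS : S.IsHermitian) :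
    Sᵀ = S := by
  rwa [Matrix.IsHermitian, Matrix.conjTranspose_eq_transpose_of_trivial] at hS

theorem inputWeight_mul_inv (hR : R.PosDef) (hX : X.PosSemidef) :
    inputWeight B R X * (inputWeight B R X)⁻¹ = 1 :=
  Matrix.mul_nonsing_inv _ ((Matrix.isUnit_iff_isUnit_det _).1 (inputWeight_posDef hR hX).isUnit)

/-- The closed-loop matrix `A - B K`. -/
def closedLoop (A : Matrix (Fin n) (Fin n) ℝ) (B : Matrix (Fin n) (Fin m) ℝ)
    (R : Matrix (Fin m) (Fin m) ℝ) (X : Matrix (Fin n) (Fin n) ℝ) : Matrix (Fin n) (Fin n) ℝ :=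
  A - B * fbGain A B R X

/-- The minimizer of the one-step cost-to-go in the error `e` with disturbance `w` and next
costate `g`. -/
def optInput (A : Matrix (Fin n) (Fin n) ℝ) (B : Matrix (Fin n) (Fin m) ℝ)
    (R : Matrix (Fin m) (Fin m) ℝ) (X : Matrix (Fin n) (Fin n) ℝ) (e w g : Fin n → ℝ) :
    Fin m → ℝ :=
  -((inputWeight B R X)⁻¹ *ᵥ Bᵀ *ᵥ (X *ᵥ (A *ᵥ e + w) + g))

/-- The linear term `g` carries the effect of future disturbances in `bellman_step`; with `g = 0`
the same identity gives the closed-loop form of the Riccati equation. -/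
theorem completeSquare (hR : R.PosDef) (hX : X.PosSemidef) (y g : Fin n → ℝ) (u : Fin m → ℝ) :
    u ⬝ᵥ R *ᵥ u + (y + B *ᵥ u) ⬝ᵥ X *ᵥ (y + B *ᵥ u) + 2 * ((y + B *ᵥ u) ⬝ᵥ g)
      = (u + (inputWeight B R X)⁻¹ *ᵥ Bᵀ *ᵥ (X *ᵥ y + g)) ⬝ᵥ inputWeight B R X *ᵥ
          (u + (inputWeight B R X)⁻¹ *ᵥ Bᵀ *ᵥ (X *ᵥ y + g))
        - (Bᵀ *ᵥ (X *ᵥ y + g)) ⬝ᵥ (inputWeight B R X)⁻¹ *ᵥ (Bᵀ *ᵥ (X *ᵥ y + g))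
        + y ⬝ᵥ X *ᵥ y + 2 * (y ⬝ᵥ g) := by
  set L := inputWeight B R X with hL
  set b := Bᵀ *ᵥ (X *ᵥ y + g) with hb
  have hLt : Lᵀ = L := transpose_eq_of_isHermitian (inputWeight_posDef hR hX).isHermitian
  have hXt : Xᵀ = X := transpose_eq_of_isHermitian hX.isHermitian
  have h1 : L *ᵥ (L⁻¹ *ᵥ b) = b := by
    rw [Matrix.mulVec_mulVec, inputWeight_mul_inv hR hX, Matrix.one_mulVec]
  have h2 : (L⁻¹ *ᵥ b) ⬝ᵥ L *ᵥ u = u ⬝ᵥ b := by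
    rw [dotProduct_mulVec_comm hLt, h1]
  have h3 : u ⬝ᵥ L *ᵥ u = u ⬝ᵥ R *ᵥ u + (B *ᵥ u) ⬝ᵥ X *ᵥ (B *ᵥ u) := by
    rw [hL, inputWeight, Matrix.add_mulVec, dotProduct_add, ← Matrix.mulVec_mulVec,
      ← Matrix.mulVec_mulVec, dotProduct_mulVec_transpose, dotProduct_comm (X *ᵥ B *ᵥ u)]
  have h4 : u ⬝ᵥ b = (B *ᵥ u) ⬝ᵥ X *ᵥ y + (B *ᵥ u) ⬝ᵥ g := by
    rw [hb, dotProduct_mulVec_transpose, dotProduct_comm, dotProduct_add]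
  have h5 := dotProduct_mulVec_comm hXt y (B *ᵥ u)
  simp only [Matrix.mulVec_add, dotProduct_add, add_dotProduct, h1, h2]
  have h6 := dotProduct_comm b (L⁻¹ *ᵥ b)
  linarith

theorem transpose_closedLoop_mulVec (hX : X.PosSemidef) (hR : R.PosDef) (v : Fin n → ℝ) :
    (closedLoop A B R X)ᵀ *ᵥ v
      = Aᵀ *ᵥ v - Aᵀ *ᵥ X *ᵥ B *ᵥ (inputWeight B R X)⁻¹ *ᵥ Bᵀ *ᵥ v := by
  have hLt : (inputWeight B R X)⁻¹ᵀ = (inputWeight B R X)⁻¹ :=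
    transpose_eq_of_isHermitian (inputWeight_posDef hR hX).inv.isHermitian
  have hXt : Xᵀ = X := transpose_eq_of_isHermitian hX.isHermitian
  have hK : fbGain A B R X = (inputWeight B R X)⁻¹ * (Bᵀ * X * A) := rfl
  rw [closedLoop, hK]
  generalize (inputWeight B R X)⁻¹ = L at hLt ⊢
  simp only [Matrix.transpose_sub, Matrix.transpose_mul, hLt, hXt,
    Matrix.transpose_transpose, Matrix.sub_mulVec, Matrix.mulVec_mulVec, Matrix.mul_assoc]

theorem riccati_quadratic (hX : IsRiccatiSolution A B Q R X) (e : Fin n → ℝ) :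
    e ⬝ᵥ X *ᵥ e = e ⬝ᵥ Q *ᵥ e + (A *ᵥ e) ⬝ᵥ X *ᵥ (A *ᵥ e)
      - (Bᵀ *ᵥ X *ᵥ A *ᵥ e) ⬝ᵥ (inputWeight B R X)⁻¹ *ᵥ (Bᵀ *ᵥ X *ᵥ A *ᵥ e) := by
  have hXt : Xᵀ = X := transpose_eq_of_isHermitian hX.1.isHermitian
  have h : X *ᵥ e = Q *ᵥ e + Aᵀ *ᵥ X *ᵥ A *ᵥ e
      - Aᵀ *ᵥ X *ᵥ B *ᵥ (inputWeight B R X)⁻¹ *ᵥ (Bᵀ *ᵥ X *ᵥ A *ᵥ e) := by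
    conv_lhs => rw [hX.2]
    simp only [Matrix.sub_mulVec, Matrix.add_mulVec, Matrix.mulVec_mulVec, Matrix.mul_assoc,
      inputWeight]
  rw [h]
  simp only [dotProduct_sub, dotProduct_add]
  generalize (inputWeight B R X)⁻¹ *ᵥ Bᵀ *ᵥ X *ᵥ A *ᵥ e = z
  rw [dotProduct_mulVec_transpose, dotProduct_mulVec_transpose, dotProduct_comm (X *ᵥ A *ᵥ e),
    dotProduct_comm (X *ᵥ B *ᵥ z), dotProduct_mulVec_comm hXt (A *ᵥ e) (B *ᵥ z),
    dotProduct_comm (B *ᵥ z), ← dotProduct_mulVec_transpose B, dotProduct_comm z]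

/-- One step of dynamic programming for the tracking error with disturbance. -/
theorem bellman_step (hR : R.PosDef) (hX : IsRiccatiSolution A B Q R X) (e w q : Fin n → ℝ)
    (u : Fin m → ℝ) :
    e ⬝ᵥ Q *ᵥ e + u ⬝ᵥ R *ᵥ u
      = (e ⬝ᵥ X *ᵥ e + 2 * (e ⬝ᵥ (closedLoop A B R X)ᵀ *ᵥ (X *ᵥ w + q)))
        - ((A *ᵥ e + B *ᵥ u + w) ⬝ᵥ X *ᵥ (A *ᵥ e + B *ᵥ u + w)
            + 2 * ((A *ᵥ e + B *ᵥ u + w) ⬝ᵥ q))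
        + (w ⬝ᵥ X *ᵥ w + 2 * (w ⬝ᵥ q)
            - (Bᵀ *ᵥ (X *ᵥ w + q)) ⬝ᵥ (inputWeight B R X)⁻¹ *ᵥ (Bᵀ *ᵥ (X *ᵥ w + q)))
        + (u - optInput A B R X e w q) ⬝ᵥ inputWeight B R X *ᵥ (u - optInput A B R X e w q) := by
  have hXt : Xᵀ = X := transpose_eq_of_isHermitian hX.1.isHermitian
  have hLt : (inputWeight B R X)⁻¹ᵀ = (inputWeight B R X)⁻¹ :=
    transpose_eq_of_isHermitian (inputWeight_posDef hR hX.1).inv.isHermitian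
  -- After the square in `u` is split off, the terms quadratic in `e` match by the Riccati equation
  -- and those linear in `e` combine into the closed-loop transpose, which propagates the costate.
  have h1 := completeSquare (B := B) hR hX.1 (A *ᵥ e + w) q u
  have h2 := riccati_quadratic hX e
  rw [show A *ᵥ e + B *ᵥ u + w = A *ᵥ e + w + B *ᵥ u by abel, optInput, sub_neg_eq_add,
    transpose_closedLoop_mulVec hX.1 hR]
  have h3 : X *ᵥ (A *ᵥ e + w) + q = X *ᵥ A *ᵥ e + (X *ᵥ w + q) := by
    rw [Matrix.mulVec_add]; abel
  have h5 : e ⬝ᵥ Aᵀ *ᵥ (X *ᵥ w + q) = (A *ᵥ e) ⬝ᵥ X *ᵥ w + (A *ᵥ e) ⬝ᵥ q := by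
    rw [dotProduct_mulVec_transpose, dotProduct_comm, dotProduct_add]
  have h6 : e ⬝ᵥ Aᵀ *ᵥ X *ᵥ B *ᵥ (inputWeight B R X)⁻¹ *ᵥ Bᵀ *ᵥ (X *ᵥ w + q)
      = (Bᵀ *ᵥ X *ᵥ A *ᵥ e) ⬝ᵥ (inputWeight B R X)⁻¹ *ᵥ (Bᵀ *ᵥ (X *ᵥ w + q)) := by
    rw [dotProduct_mulVec_transpose, dotProduct_comm, dotProduct_mulVec_comm hXt,
      dotProduct_comm, ← dotProduct_mulVec_transpose, dotProduct_comm]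
  have h7 : (Bᵀ *ᵥ (X *ᵥ (A *ᵥ e + w) + q)) ⬝ᵥ (inputWeight B R X)⁻¹ *ᵥ
        (Bᵀ *ᵥ (X *ᵥ (A *ᵥ e + w) + q))
      = (Bᵀ *ᵥ X *ᵥ A *ᵥ e) ⬝ᵥ (inputWeight B R X)⁻¹ *ᵥ (Bᵀ *ᵥ X *ᵥ A *ᵥ e)
        + 2 * ((Bᵀ *ᵥ X *ᵥ A *ᵥ e) ⬝ᵥ (inputWeight B R X)⁻¹ *ᵥ (Bᵀ *ᵥ (X *ᵥ w + q)))
        + (Bᵀ *ᵥ (X *ᵥ w + q)) ⬝ᵥ (inputWeight B R X)⁻¹ *ᵥ (Bᵀ *ᵥ (X *ᵥ w + q)) := by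
    rw [h3, Matrix.mulVec_add Bᵀ]
    generalize Bᵀ *ᵥ X *ᵥ A *ᵥ e = a
    generalize Bᵀ *ᵥ (X *ᵥ w + q) = b
    rw [Matrix.mulVec_add, dotProduct_add, add_dotProduct, add_dotProduct,
      dotProduct_mulVec_comm hLt b a]
    ring
  have h8 : (A *ᵥ e + w) ⬝ᵥ X *ᵥ (A *ᵥ e + w)
      = (A *ᵥ e) ⬝ᵥ X *ᵥ (A *ᵥ e) + 2 * ((A *ᵥ e) ⬝ᵥ X *ᵥ w) + w ⬝ᵥ X *ᵥ w := by
    rw [Matrix.mulVec_add, dotProduct_add, add_dotProduct, add_dotProduct,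
      dotProduct_mulVec_comm hXt w (A *ᵥ e)]
    ring
  have h9 : (A *ᵥ e + w) ⬝ᵥ q = (A *ᵥ e) ⬝ᵥ q + w ⬝ᵥ q := add_dotProduct _ _ _
  rw [dotProduct_sub, h5, h6]
  linarith

/-- The target-induced disturbance `A r_t - r_{t+1}` of the tracking error. -/
def disturbance (A : Matrix (Fin n) (Fin n) ℝ) (r : ℤ → Fin n → ℝ) (t : ℕ) : Fin n → ℝ :=
  A *ᵥ r t - r (t + 1)

/-- `∑_{i < N} ((A - B K)ᵀ)^i X w_{t+i}`. -/
def costate (A : Matrix (Fin n) (Fin n) ℝ) (B : Matrix (Fin n) (Fin m) ℝ)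
    (R : Matrix (Fin m) (Fin m) ℝ) (X : Matrix (Fin n) (Fin n) ℝ) (r : ℤ → Fin n → ℝ)
    (t N : ℕ) : Fin n → ℝ :=
  ∑ i ∈ Finset.range N, ((closedLoop A B R X)ᵀ) ^ i *ᵥ X *ᵥ disturbance A r (t + i)

theorem costate_succ (r : ℤ → Fin n → ℝ) (t N : ℕ) :
    costate A B R X r t (N + 1) = X *ᵥ disturbance A r t
      + (closedLoop A B R X)ᵀ *ᵥ costate A B R X r (t + 1) N := by
  rw [costate, Finset.sum_range_succ', costate, Matrix.mulVec_sum, add_comm]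
  congr 1
  · simp
  · refine Finset.sum_congr rfl fun i _ => ?_
    rw [pow_succ', ← Matrix.mulVec_mulVec, show t + (i + 1) = t + 1 + i by omega]

/-- The optimal input at time `t` in state `x` when the target is known. -/
def oracleInput (A : Matrix (Fin n) (Fin n) ℝ) (B : Matrix (Fin n) (Fin m) ℝ)
    (R : Matrix (Fin m) (Fin m) ℝ) (X : Matrix (Fin n) (Fin n) ℝ) (T : ℕ) (r : ℤ → Fin n → ℝ)
    (t : ℕ) (x : Fin n → ℝ) : Fin m → ℝ :=
  -(fbGain A B R X *ᵥ (x - r t))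
    - ∑ i ∈ Finset.range (T - t), ffGain A B R X i *ᵥ disturbance A r (t + i)

/-- Unrolling the costate recursion turns the one-step minimizer into feedback plus feedforward, the
form in which PLOT merely replaces the future target by predictions. -/
theorem oracleInput_eq (T : ℕ) (r : ℤ → Fin n → ℝ) {t : ℕ} (ht : t < T) (x : Fin n → ℝ) :
    oracleInput A B R X T r t x = optInput A B R X (x - r t) (disturbance A r t)
      ((closedLoop A B R X)ᵀ *ᵥ costate A B R X r (t + 1) (T - (t + 1))) := by
  have h1 : X *ᵥ (A *ᵥ (x - r t) + disturbance A r t)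
      + (closedLoop A B R X)ᵀ *ᵥ costate A B R X r (t + 1) (T - (t + 1))
      = X *ᵥ A *ᵥ (x - r t) + costate A B R X r t (T - t) := by
    rw [show T - t = T - (t + 1) + 1 by omega, costate_succ, Matrix.mulVec_add, add_assoc]
  rw [optInput, h1, oracleInput, Matrix.mulVec_add, Matrix.mulVec_add, neg_add, sub_eq_add_neg]
  congr 2
  · simp only [fbGain, inputWeight, Matrix.mulVec_mulVec, Matrix.mul_assoc]
  · rw [costate, Matrix.mulVec_sum, Matrix.mulVec_sum]
    refine Finset.sum_congr rfl fun i _ => ?_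
    simp only [ffGain, inputWeight, closedLoop, Matrix.mulVec_mulVec, Matrix.mul_assoc]

/-- Summing the Bellman step telescopes the value function `V`. At time `T` the costate is an empty
sum, so `V T` is exactly the terminal cost with weight `X`; the remaining `κ` involves the target
only, hence the constant does not depend on `u`. -/
theorem lqtCost_eq (hR : R.PosDef) (hX : IsRiccatiSolution A B Q R X) (T : ℕ)
    (r : ℤ → Fin n → ℝ) (x₀ : Fin n → ℝ) :
    ∃ c : ℝ, ∀ u : ℕ → Fin m → ℝ, lqtCost A B Q R X T r x₀ u = c + ∑ t ∈ Finset.range T,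
      (u t - oracleInput A B R X T r t (stateTraj A B x₀ u t)) ⬝ᵥ inputWeight B R X *ᵥ
        (u t - oracleInput A B R X T r t (stateTraj A B x₀ u t)) := by
  let q : ℕ → Fin n → ℝ := fun t => (closedLoop A B R X)ᵀ *ᵥ costate A B R X r t (T - t)
  let V : ℕ → (Fin n → ℝ) → ℝ := fun t e => e ⬝ᵥ X *ᵥ e + 2 * (e ⬝ᵥ q t)
  let κ : ℕ → ℝ := fun t => disturbance A r t ⬝ᵥ X *ᵥ disturbance A r t
    + 2 * (disturbance A r t ⬝ᵥ q (t + 1))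
    - (Bᵀ *ᵥ (X *ᵥ disturbance A r t + q (t + 1))) ⬝ᵥ (inputWeight B R X)⁻¹ *ᵥ
      (Bᵀ *ᵥ (X *ᵥ disturbance A r t + q (t + 1)))
  refine ⟨V 0 (x₀ - r 0) + ∑ t ∈ Finset.range T, κ t, fun u => ?_⟩
  set x := stateTraj A B x₀ u with hx
  have hstep : ∀ t ∈ Finset.range T, (x t - r t) ⬝ᵥ Q *ᵥ (x t - r t) + u t ⬝ᵥ R *ᵥ u t
      = -(V (t + 1) (x (t + 1) - r (t + 1 : ℕ)) - V t (x t - r t)) + κ t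
        + (u t - oracleInput A B R X T r t (x t)) ⬝ᵥ inputWeight B R X *ᵥ
          (u t - oracleInput A B R X T r t (x t)) := by
    intro t ht
    have ht' := Finset.mem_range.1 ht
    have h1 : x (t + 1) - r (t + 1 : ℕ) = A *ᵥ (x t - r t) + B *ᵥ u t + disturbance A r t := by
      rw [hx, stateTraj, disturbance, Matrix.mulVec_sub]
      push_cast
      abel
    have h2 : q t = (closedLoop A B R X)ᵀ *ᵥ (X *ᵥ disturbance A r t + q (t + 1)) := by
      simp only [q]
      rw [show T - t = T - (t + 1) + 1 by omega, costate_succ]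
    rw [bellman_step hR hX (x t - r t) (disturbance A r t) (q (t + 1)) (u t),
      oracleInput_eq T r ht', h1]
    simp only [V, κ, h2]
    simp only [q]
    ring
  rw [lqtCost, Finset.sum_congr rfl hstep, Finset.sum_add_distrib, Finset.sum_add_distrib,
    Finset.sum_neg_distrib, Finset.sum_range_sub (fun t => V t (x t - r t))]
  have h0 : V T (x T - r T) = (x T - r T) ⬝ᵥ X *ᵥ (x T - r T) := by
    simp [V, q, costate]
  have h00 : x 0 = x₀ := rfl
  rw [h0, h00]
  push_cast
  ring

theorem dynamicRegret_le (hR : R.PosDef) (hX : IsRiccatiSolution A B Q R X) (T : ℕ)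
    (r : ℤ → Fin n → ℝ) (x₀ : Fin n → ℝ) (u : ℕ → Fin m → ℝ) :
    dynamicRegret A B Q R X T r x₀ u ≤ maxEig (inputWeight B R X) * ∑ t ∈ Finset.range T,
      euclNorm (u t - oracleInput A B R X T r t (stateTraj A B x₀ u t)) ^ 2 := by
  obtain ⟨c, hc⟩ := lqtCost_eq (A := A) (B := B) hR hX T r x₀
  have hL := inputWeight_posDef (B := B) hR hX.1
  -- Only this lower bound on the infimum is needed; that it is attained plays no role.
  have h1 : c ≤ ⨅ v : ℕ → Fin m → ℝ, lqtCost A B Q R X T r x₀ v := by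
    refine le_ciInf fun v => ?_
    rw [hc v]
    have := Finset.sum_nonneg fun t (_ : t ∈ Finset.range T) =>
      hL.posSemidef.dotProduct_mulVec_nonneg
        (v t - oracleInput A B R X T r t (stateTraj A B x₀ v t))
    simp only [star_trivial] at this
    linarith
  rw [dynamicRegret, hc u, Finset.mul_sum]
  have h2 := Finset.sum_le_sum fun t (_ : t ∈ Finset.range T) =>
      le_maxEig_mul hL.isHermitian (u t - oracleInput A B R X T r t (stateTraj A B x₀ u t))
  simp only [euclNorm_sq]
  linarith

end Regret

/-! ### Decay of the feedforward gains -/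

section Decay

variable {n m : ℕ} {A : Matrix (Fin n) (Fin n) ℝ} {B : Matrix (Fin n) (Fin m) ℝ}
  {Q : Matrix (Fin n) (Fin n) ℝ} {R : Matrix (Fin m) (Fin m) ℝ} {X : Matrix (Fin n) (Fin n) ℝ}

/-- The closed-loop form of the Riccati equation. -/
theorem riccati_closedLoop (hR : R.PosDef) (hX : IsRiccatiSolution A B Q R X) (v : Fin n → ℝ) :
    (closedLoop A B R X *ᵥ v) ⬝ᵥ X *ᵥ (closedLoop A B R X *ᵥ v)
      + (fbGain A B R X *ᵥ v) ⬝ᵥ R *ᵥ (fbGain A B R X *ᵥ v) = v ⬝ᵥ X *ᵥ v - v ⬝ᵥ Q *ᵥ v := by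
  -- With `g = 0` the input `-K v` is the minimizer, so the completed square vanishes.
  have h1 := completeSquare (B := B) hR hX.1 (A *ᵥ v) 0 (-(fbGain A B R X *ᵥ v))
  have h2 := riccati_quadratic hX v
  have h3 : (inputWeight B R X)⁻¹ *ᵥ Bᵀ *ᵥ (X *ᵥ A *ᵥ v + 0) = fbGain A B R X *ᵥ v := by
    simp only [fbGain, inputWeight, Matrix.mulVec_mulVec, Matrix.mul_assoc, add_zero]
  have h4 : A *ᵥ v + B *ᵥ (-(fbGain A B R X *ᵥ v)) = closedLoop A B R X *ᵥ v := by
    rw [closedLoop, Matrix.sub_mulVec, Matrix.mulVec_neg, Matrix.mulVec_mulVec, sub_eq_add_neg]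
  rw [h3, h4, neg_add_cancel, Matrix.mulVec_zero] at h1
  simp only [dotProduct_zero, add_zero, Matrix.mulVec_neg, neg_dotProduct_neg, mul_zero,
    zero_sub] at h1
  rw [add_zero] at h3
  rw [h3] at h2
  linarith

theorem riccati_ge (hR : R.PosDef) (hX : IsRiccatiSolution A B Q R X) (v : Fin n → ℝ) :
    v ⬝ᵥ Q *ᵥ v ≤ v ⬝ᵥ X *ᵥ v := by
  have h1 := riccati_closedLoop hR hX v
  have h2 := hX.1.dotProduct_mulVec_nonneg (closedLoop A B R X *ᵥ v)
  have h3 := hR.posSemidef.dotProduct_mulVec_nonneg (fbGain A B R X *ᵥ v)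
  simp only [star_trivial] at h2 h3
  linarith

theorem riccati_posDef (hQ : Q.PosDef) (hR : R.PosDef) (hX : IsRiccatiSolution A B Q R X) :
    X.PosDef := by
  refine Matrix.PosDef.of_dotProduct_mulVec_pos hX.1.isHermitian fun v hv => ?_
  have := hQ.dotProduct_mulVec_pos hv
  simp only [star_trivial] at this ⊢
  exact this.trans_le (riccati_ge hR hX v)

theorem maxEig_pos [NeZero n] (hX : X.PosDef) : 0 < maxEig X := by
  have h : (Pi.single 0 1 : Fin n → ℝ) ≠ 0 := by simp
  have h1 := hX.dotProduct_mulVec_pos h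
  have h2 := le_maxEig_mul hX.isHermitian (Pi.single 0 1 : Fin n → ℝ)
  simp only [star_trivial] at h1
  have h3 : (Pi.single 0 1 : Fin n → ℝ) ⬝ᵥ Pi.single 0 1 = 1 := by simp
  rw [h3, mul_one] at h2
  linarith

/-- A positive root has a positive radicand, so `Real.sqrt` does not truncate here. -/
theorem decayRate_sq (hρ : 0 < decayRate Q X) :
    decayRate Q X ^ 2 = 1 - minEig Q / maxEig X := by
  rw [decayRate, Real.sq_sqrt (Real.sqrt_pos.1 hρ).le]

theorem decayRate_lt_one [NeZero n] (hQ : Q.PosDef) (hX : X.PosDef) : decayRate Q X < 1 := by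
  rw [decayRate, Real.sqrt_lt' one_pos]
  have := div_pos (minEig_pos hQ) (maxEig_pos hX)
  linarith

/-- One closed-loop step lowers `v ⬝ᵥ X *ᵥ v` by at least `v ⬝ᵥ Q *ᵥ v`, which is at least the
fraction `minEig Q / maxEig X` of it. -/
theorem closedLoop_contraction [NeZero n] (hQ : Q.PosDef) (hR : R.PosDef)
    (hX : IsRiccatiSolution A B Q R X) (hρ : 0 < decayRate Q X) (v : Fin n → ℝ) :
    (closedLoop A B R X *ᵥ v) ⬝ᵥ X *ᵥ (closedLoop A B R X *ᵥ v)
      ≤ decayRate Q X ^ 2 * (v ⬝ᵥ X *ᵥ v) := by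
  have h1 := riccati_closedLoop hR hX v
  have h3 := hR.posSemidef.dotProduct_mulVec_nonneg (fbGain A B R X *ᵥ v)
  simp only [star_trivial] at h3
  have h4 := minEig_mul_le hQ.isHermitian v
  have h5 := le_maxEig_mul hX.1.isHermitian v
  have hM := maxEig_pos (riccati_posDef hQ hR hX)
  have h6 : minEig Q / maxEig X * (v ⬝ᵥ X *ᵥ v) ≤ minEig Q * (v ⬝ᵥ v) := by
    rw [div_mul_eq_mul_div, div_le_iff₀ hM]
    nlinarith [minEig_pos hQ]
  rw [decayRate_sq hρ]
  linarith

theorem closedLoop_pow_le [NeZero n] (hQ : Q.PosDef) (hR : R.PosDef)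
    (hX : IsRiccatiSolution A B Q R X) (hρ : 0 < decayRate Q X) (v : Fin n → ℝ) (i : ℕ) :
    (closedLoop A B R X ^ i *ᵥ v) ⬝ᵥ X *ᵥ (closedLoop A B R X ^ i *ᵥ v)
      ≤ (decayRate Q X ^ i) ^ 2 * (v ⬝ᵥ X *ᵥ v) := by
  induction i with
  | zero => simp
  | succ i ih =>
    rw [pow_succ' (closedLoop A B R X), ← Matrix.mulVec_mulVec]
    refine (closedLoop_contraction hQ hR hX hρ _).trans ?_
    calc _ ≤ decayRate Q X ^ 2 * ((decayRate Q X ^ i) ^ 2 * (v ⬝ᵥ X *ᵥ v)) := by gcongr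
      _ = _ := by ring

theorem exists_specNorm_closedLoop_pow_le [NeZero n] (hQ : Q.PosDef) (hR : R.PosDef)
    (hX : IsRiccatiSolution A B Q R X) (hρ : 0 < decayRate Q X) :
    ∃ c : ℝ, 0 ≤ c ∧ ∀ i, specNorm (closedLoop A B R X ^ i) ≤ c * decayRate Q X ^ i := by
  have hXp := riccati_posDef hQ hR hX
  have ha := minEig_pos hXp
  -- The root of the condition number of `X` is the price of passing from the `X`-norm to the
  -- Euclidean norm and back.
  refine ⟨Real.sqrt (maxEig X / minEig X), Real.sqrt_nonneg _, fun i =>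
    specNorm_le_of_forall (by positivity) fun v => ?_⟩
  refine le_of_sq_le_sq ?_ (mul_nonneg (by positivity) (euclNorm_nonneg _))
  rw [mul_pow, mul_pow, Real.sq_sqrt (div_pos (maxEig_pos hXp) ha).le, euclNorm_sq, euclNorm_sq]
  have h1 := closedLoop_pow_le hQ hR hX hρ v i
  have h2 := minEig_mul_le hX.1.isHermitian (closedLoop A B R X ^ i *ᵥ v)
  have h3 := le_maxEig_mul hX.1.isHermitian v
  rw [show maxEig X / minEig X * (decayRate Q X ^ i) ^ 2 * (v ⬝ᵥ v)
    = ((decayRate Q X ^ i) ^ 2 * (maxEig X * (v ⬝ᵥ v))) / minEig X by ring, le_div_iff₀ ha]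
  have h4 := mul_le_mul_of_nonneg_left h3 (sq_nonneg (decayRate Q X ^ i))
  linarith

theorem exists_specNorm_ffGain_le [NeZero n] (hQ : Q.PosDef) (hR : R.PosDef)
    (hX : IsRiccatiSolution A B Q R X) (hρ : 0 < decayRate Q X) :
    ∃ c : ℝ, 0 ≤ c ∧ ∀ i, specNorm (ffGain A B R X i) ≤ c * decayRate Q X ^ i := by
  obtain ⟨c, hc, h⟩ := exists_specNorm_closedLoop_pow_le hQ hR hX hρ
  refine ⟨specNorm ((R + Bᵀ * X * B)⁻¹ * Bᵀ) * c * specNorm X,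
    mul_nonneg (mul_nonneg (specNorm_nonneg _) hc) (specNorm_nonneg _), fun i => ?_⟩
  have h1 : specNorm (((closedLoop A B R X)ᵀ) ^ i) ≤ c * decayRate Q X ^ i := by
    rw [← Matrix.transpose_pow, specNorm_transpose]
    exact h i
  change specNorm ((R + Bᵀ * X * B)⁻¹ * Bᵀ * ((closedLoop A B R X)ᵀ) ^ i * X) ≤ _
  calc _ ≤ specNorm ((R + Bᵀ * X * B)⁻¹ * Bᵀ * ((closedLoop A B R X)ᵀ) ^ i) * specNorm X :=
        specNorm_mul_le _ _
    _ ≤ specNorm ((R + Bᵀ * X * B)⁻¹ * Bᵀ) * (c * decayRate Q X ^ i) * specNorm X := by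
        refine mul_le_mul_of_nonneg_right ?_ (specNorm_nonneg _)
        exact (specNorm_mul_le _ _).trans (mul_le_mul_of_nonneg_left h1 (specNorm_nonneg _))
    _ = _ := by ring

end Decay

/-! ### Multi-step target dynamics -/

section Dynamics

variable {n p : ℕ} {T : ℕ} {M D : ℝ} {r : ℤ → Fin n → ℝ}
  {S : ℕ → Matrix (Fin n) (Fin p × Fin n) ℝ}

theorem outputMatrix_mul_apply (hp : 0 < p) {β : Type} (Φ : Matrix (Fin p × Fin n) β ℝ)
    (i : Fin n) (b : β) : (outputMatrix n p * Φ) i b = Φ (⟨0, hp⟩, i) b := by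
  rw [Matrix.mul_apply, Finset.sum_eq_single (⟨0, hp⟩, i)]
  · simp [outputMatrix]
  · rintro ⟨a, j⟩ - hne
    have : ¬((a : ℕ) = 0 ∧ i = j) := by
      rintro ⟨h1, rfl⟩
      exact hne (Prod.ext (Fin.ext h1) rfl)
    simp [outputMatrix, this]
  · simp

theorem outputMatrix_mulVec_regressor (hp : 0 < p) (r : ℤ → Fin n → ℝ) (t : ℤ) :
    outputMatrix n p *ᵥ regressor p r t = r t := by
  ext i
  have h := outputMatrix_mul_apply hp (Matrix.replicateCol Unit (regressor p r t)) i ()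
  rw [Matrix.replicateCol_apply] at h
  rw [show (outputMatrix n p *ᵥ regressor p r t) i = regressor p r t (⟨0, hp⟩, i) from h]
  simp [regressor]

theorem companion_mul_apply_succ {β : Type} (S : Matrix (Fin n) (Fin p × Fin n) ℝ)
    (Φ : Matrix (Fin p × Fin n) β ℝ) (j : ℕ) (hj : j + 1 < p) (i : Fin n) (b : β) :
    (companion S * Φ) (⟨j + 1, hj⟩, i) b = Φ (⟨j, by omega⟩, i) b := by
  rw [Matrix.mul_apply, Finset.sum_eq_single (⟨j, by omega⟩, i)]
  · simp [companion]
  · rintro ⟨a, l⟩ - hne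
    have : ¬(j = (a : ℕ) ∧ i = l) := by
      rintro ⟨h1, rfl⟩
      exact hne (Prod.ext (Fin.ext h1.symm) rfl)
    simp [companion, this]
  · simp

theorem companion_mulVec_regressor (r : ℤ → Fin n → ℝ)
    (S : Matrix (Fin n) (Fin p × Fin n) ℝ) (t : ℤ) (h : r (t + 1) = S *ᵥ regressor p r t) :
    companion S *ᵥ regressor p r t = regressor p r (t + 1) := by
  ext ⟨⟨a, ha⟩, i⟩
  rcases a with _ | j
  · have h1 : (companion S *ᵥ regressor p r t) (⟨0, ha⟩, i) = (S *ᵥ regressor p r t) i := by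
      simp [companion, Matrix.mulVec, dotProduct]
    rw [h1, ← h]
    simp [regressor]
  · have h1 := companion_mul_apply_succ S (Matrix.replicateCol Unit (regressor p r t)) j ha i ()
    rw [Matrix.replicateCol_apply] at h1
    rw [show (companion S *ᵥ regressor p r t) (⟨j + 1, ha⟩, i) = _ from h1]
    simp only [regressor]
    rw [show t + 1 - ((j + 1 : ℕ) : ℤ) = t - (j : ℕ) by push_cast; ring]

theorem transition_mulVec_regressor (h : IsTarget T M D r S) (t k : ℕ) (htk : t + k ≤ T) :
    transition S t k *ᵥ regressor p r t = regressor p r (t + k : ℕ) := by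
  induction k with
  | zero => simp [transition]
  | succ k ih =>
    rw [transition, ← Matrix.mulVec_mulVec, ih (by omega), companion_mulVec_regressor]
    · push_cast; ring_nf
    · have := h.dynamics (t + k) (by omega)
      exact_mod_cast this

theorem multiStep_mulVec_regressor (hp : 0 < p) (h : IsTarget T M D r S) (t k : ℕ)
    (htk : t + k ≤ T) : multiStep S t k *ᵥ regressor p r t = r (t + k : ℕ) := by
  rw [multiStep, ← Matrix.mulVec_mulVec, transition_mulVec_regressor h t k htk,
    outputMatrix_mulVec_regressor hp]

/-- Companion products only shift block rows down, so every row is a row of the identity or of some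
multi-step matrix over fewer or equally many steps. Membership of these in `𝒮` bounds the transition
matrices uniformly in `k`, without any stability assumption. -/
theorem transition_row_le (hp : 0 < p) (h : IsTarget T M D r S) (t k : ℕ) (htk : t + k ≤ T)
    (a : Fin p × Fin n) : transition S t k a ⬝ᵥ transition S t k a ≤ M ^ 2 + 1 := by
  induction k generalizing a with
  | zero =>
    simp only [transition]
    have : (1 : Matrix (Fin p × Fin n) (Fin p × Fin n) ℝ) a ⬝ᵥ
        (1 : Matrix (Fin p × Fin n) (Fin p × Fin n) ℝ) a = 1 := by
      simp [dotProduct, Matrix.one_apply]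
    rw [this]
    nlinarith [sq_nonneg M]
  | succ k ih =>
    obtain ⟨⟨a, ha⟩, i⟩ := a
    rcases a with _ | j
    · have h1 : transition S t (k + 1) (⟨0, ha⟩, i) = multiStep S t (k + 1) i := by
        ext b
        rw [multiStep, outputMatrix_mul_apply hp]
      rw [h1]
      have := dotProduct_row_self_le (h.multiStep_mem t (k + 1) (by omega) htk) i
      linarith
    · have h1 : transition S t (k + 1) (⟨j + 1, ha⟩, i) = transition S t k (⟨j, by omega⟩, i) := by
        ext b
        rw [transition, companion_mul_apply_succ]
      rw [h1]
      exact ih (by omega) _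

theorem frobNorm_transition_le (hp : 0 < p) (h : IsTarget T M D r S) (t k : ℕ)
    (htk : t + k ≤ T) : frobNorm (transition S t k) ≤ Real.sqrt (p * n * (M ^ 2 + 1)) := by
  refine Real.le_sqrt_of_sq_le ?_
  rw [frobNorm_sq]
  refine (Finset.sum_le_sum fun a _ => transition_row_le hp h t k htk a).trans (le_of_eq ?_)
  simp only [Finset.sum_const, Finset.card_univ, Fintype.card_prod, Fintype.card_fin, nsmul_eq_mul]
  push_cast
  ring

theorem companion_sub (S S' : Matrix (Fin n) (Fin p × Fin n) ℝ) :
    companion S - companion S' = (outputMatrix n p)ᵀ * (S - S') := by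
  ext ⟨a, i⟩ b
  rw [Matrix.mul_apply]
  by_cases ha : (a : ℕ) = 0 <;> simp [companion, outputMatrix, ha]

theorem transition_succ' (S : ℕ → Matrix (Fin n) (Fin p × Fin n) ℝ) (t k : ℕ) :
    transition S t (k + 1) = transition S (t + 1) k * companion (S (t + 1)) := by
  induction k with
  | zero => simp [transition]
  | succ k ih =>
    rw [transition, ih, transition, Matrix.mul_assoc,
      show t + (k + 1) + 1 = t + 1 + k + 1 by omega]

/-- Telescoping over hybrid products that use the factors after `s` for the first `j` steps and
those after `t` for the rest. -/
theorem transition_sub (S : ℕ → Matrix (Fin n) (Fin p × Fin n) ℝ) (t s k : ℕ) :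
    transition S t k - transition S s k = ∑ j ∈ Finset.range k,
      transition S (t + j + 1) (k - j - 1) * (companion (S (t + j + 1)) - companion (S (s + j + 1)))
        * transition S s j := by
  have h1 : ∀ j ∈ Finset.range k, transition S (t + j + 1) (k - j - 1)
      * (companion (S (t + j + 1)) - companion (S (s + j + 1))) * transition S s j
      = -(transition S (t + (j + 1)) (k - (j + 1)) * transition S s (j + 1)
        - transition S (t + j) (k - j) * transition S s j) := by
    intro j hj
    have h2 := transition_succ' S (t + j) (k - (j + 1))
    have h3 : transition S s (j + 1) = companion (S (s + j + 1)) * transition S s j := rfl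
    rw [show k - j = k - (j + 1) + 1 by have := Finset.mem_range.1 hj; omega, h2, h3,
      Nat.add_sub_cancel, ← add_assoc, Matrix.mul_sub, Matrix.sub_mul,
      Matrix.mul_assoc _ (companion (S (s + j + 1))), neg_sub]
  rw [Finset.sum_congr rfl h1, Finset.sum_neg_distrib,
    Finset.sum_range_sub (fun j => transition S (t + j) (k - j) * transition S s j)]
  simp [transition]

/-- The variation of the `k`-step dynamics in terms of that of the one-step dynamics. -/
theorem frobNorm_multiStep_sub_le (hp : 0 < p) (h : IsTarget T M D r S) (t s k : ℕ)
    (ht : t + k ≤ T) (hs : s + k ≤ T) :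
    frobNorm (multiStep S t k - multiStep S s k)
      ≤ frobNorm (outputMatrix n p) * frobNorm (outputMatrix n p)ᵀ * (p * n * (M ^ 2 + 1))
        * ∑ j ∈ Finset.range k, frobNorm (S (t + j + 1) - S (s + j + 1)) := by
  set c := Real.sqrt (p * n * (M ^ 2 + 1)) with hc
  have hcc : c * c = p * n * (M ^ 2 + 1) := Real.mul_self_sqrt (by positivity)
  have hc0 : 0 ≤ c := Real.sqrt_nonneg _
  rw [multiStep, multiStep, ← Matrix.mul_sub, transition_sub, ← hcc, mul_assoc, mul_assoc]
  refine (frobNorm_mul_le _ _).trans (mul_le_mul_of_nonneg_left ?_ (frobNorm_nonneg _))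
  refine (frobNorm_sum_le _ _).trans ?_
  rw [Finset.mul_sum, Finset.mul_sum]
  refine Finset.sum_le_sum fun j hj => ?_
  have hj' := Finset.mem_range.1 hj
  have h1 := frobNorm_transition_le hp h (t + j + 1) (k - j - 1) (by omega)
  have h2 := frobNorm_transition_le hp h s j (by omega)
  rw [companion_sub]
  have h3 := frobNorm_mul_le (outputMatrix n p)ᵀ (S (t + j + 1) - S (s + j + 1))
  calc _ ≤ frobNorm (transition S (t + j + 1) (k - j - 1)) *
          frobNorm ((outputMatrix n p)ᵀ * (S (t + j + 1) - S (s + j + 1))) *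
          frobNorm (transition S s j) :=
        (frobNorm_mul_le _ _).trans
          (mul_le_mul_of_nonneg_right (frobNorm_mul_le _ _) (frobNorm_nonneg _))
    _ ≤ c * (frobNorm (outputMatrix n p)ᵀ * frobNorm (S (t + j + 1) - S (s + j + 1))) * c := by
        refine mul_le_mul (mul_le_mul h1 h3 (frobNorm_nonneg _) hc0) h2 (frobNorm_nonneg _)
          (mul_nonneg hc0 (mul_nonneg (frobNorm_nonneg _) (frobNorm_nonneg _)))
    _ = _ := by ring

theorem frobNorm_sub_le_sum (S : ℕ → Matrix (Fin n) (Fin p × Fin n) ℝ) (s k : ℕ) :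
    frobNorm (S (s + k) - S s) ≤ ∑ i ∈ Finset.range k, frobNorm (S (s + i + 1) - S (s + i)) := by
  have := Finset.sum_range_sub (fun i => S (s + i)) k
  rw [add_zero] at this
  rw [← this]
  exact frobNorm_sum_le _ _

theorem sum_shift_le_pathLength (S : ℕ → Matrix (Fin n) (Fin p × Fin n) ℝ) {N d : ℕ}
    (h : d + N ≤ T) :
    ∑ s ∈ Finset.range N, frobNorm (S (s + d + 1) - S (s + d)) ≤ pathLength T S := by
  rw [pathLength]
  calc _ = ∑ t ∈ Finset.Ico d (d + N), frobNorm (S (t + 1) - S t) := by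
        rw [Finset.sum_Ico_eq_sum_range]
        simp [add_comm d]
    _ ≤ _ := by
        refine Finset.sum_le_sum_of_subset_of_nonneg (fun t ht => ?_) fun _ _ _ => frobNorm_nonneg _
        have := Finset.mem_Ico.1 ht
        exact Finset.mem_range.2 (by omega)

/-- The factor `k²` arises because a `k`-step product has `k` factors and each of them moves over
`k` time steps between consecutive updates of one learner. Every resulting shifted sum is part of
the path length. -/
theorem sum_frobNorm_multiStep_sub_le (hp : 0 < p) (h : IsTarget T M D r S) (k : ℕ) :
    ∑ s ∈ Finset.range (T - 2 * k), frobNorm (multiStep S (s + k) k - multiStep S s k)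
      ≤ frobNorm (outputMatrix n p) * frobNorm (outputMatrix n p)ᵀ * (p * n * (M ^ 2 + 1))
        * (k ^ 2 * pathLength T S) := by
  set c := frobNorm (outputMatrix n p) * frobNorm (outputMatrix n p)ᵀ * (p * n * (M ^ 2 + 1))
  have hc : 0 ≤ c := mul_nonneg (mul_nonneg (frobNorm_nonneg _) (frobNorm_nonneg _))
    (by positivity)
  calc _ ≤ ∑ s ∈ Finset.range (T - 2 * k), c * ∑ j ∈ Finset.range k, ∑ i ∈ Finset.range k,
          frobNorm (S (s + (j + 1 + i) + 1) - S (s + (j + 1 + i))) := by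
        refine Finset.sum_le_sum fun s hs => ?_
        have hs' := Finset.mem_range.1 hs
        refine (frobNorm_multiStep_sub_le hp h (s + k) s k (by omega) (by omega)).trans
          (mul_le_mul_of_nonneg_left (Finset.sum_le_sum fun j _ => ?_) hc)
        have h1 := frobNorm_sub_le_sum S (s + j + 1) k
        rw [show s + k + j + 1 = s + j + 1 + k by omega]
        refine h1.trans (le_of_eq (Finset.sum_congr rfl fun i _ => ?_))
        rw [show s + j + 1 + i = s + (j + 1 + i) by omega]
    _ = c * ∑ j ∈ Finset.range k, ∑ i ∈ Finset.range k, ∑ s ∈ Finset.range (T - 2 * k),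
          frobNorm (S (s + (j + 1 + i) + 1) - S (s + (j + 1 + i))) := by
        rw [← Finset.mul_sum, Finset.sum_comm]
        refine congrArg (c * ·) ?_
        exact Finset.sum_congr rfl fun j _ => Finset.sum_comm
    _ ≤ c * ∑ j ∈ Finset.range k, ∑ i ∈ Finset.range k, pathLength T S := by
        refine mul_le_mul_of_nonneg_left (Finset.sum_le_sum fun j hj =>
          Finset.sum_le_sum fun i hi => ?_) hc
        have hj' := Finset.mem_range.1 hj
        have hi' := Finset.mem_range.1 hi
        by_cases hk : 2 * k ≤ T
        · exact sum_shift_le_pathLength S (by omega)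
        · rw [show T - 2 * k = 0 by omega]
          simpa [pathLength] using Finset.sum_nonneg fun t _ => frobNorm_nonneg (S (t + 1) - S t)
    _ = _ := by
        simp only [Finset.sum_const, Finset.card_range, nsmul_eq_mul]
        ring

theorem euclNorm_regressor_sq_le (h : IsTarget T M D r S) (t : ℤ) (ht : t ≤ T) :
    regressor p r t ⬝ᵥ regressor p r t ≤ p * D ^ 2 := by
  have h1 : regressor p r t ⬝ᵥ regressor p r t
      = ∑ a : Fin p, r (t - (a : ℕ)) ⬝ᵥ r (t - (a : ℕ)) := by
    simp only [dotProduct, Fintype.sum_prod_type, regressor]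
  rw [h1]
  calc _ ≤ ∑ _a : Fin p, D ^ 2 := by
        refine Finset.sum_le_sum fun a _ => ?_
        rw [← euclNorm_sq]
        exact pow_le_pow_left₀ (euclNorm_nonneg _) (h.bounded _ (by omega)) 2
    _ = _ := by simp

end Dynamics

/-! ### Weighted Frobenius norms and projections -/

section Projection

variable {α β : Type} [Fintype α] [Fintype β]

theorem wFrobSq_eq_sum (P : Matrix β β ℝ) (S : Matrix α β ℝ) :
    wFrobSq P S = ∑ i, S i ⬝ᵥ P *ᵥ S i := by
  simp only [wFrobSq, Matrix.trace, Matrix.diag_apply]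
  refine Finset.sum_congr rfl fun i _ => ?_
  rw [Matrix.dotProduct_mulVec]
  rfl

theorem wFrobSq_nonneg {P : Matrix β β ℝ} (hP : P.PosSemidef) (S : Matrix α β ℝ) :
    0 ≤ wFrobSq P S := by
  rw [wFrobSq_eq_sum]
  exact Finset.sum_nonneg fun i _ => by simpa using hP.dotProduct_mulVec_nonneg (S i)

theorem wFrobSq_le {P : Matrix β β ℝ} {b : ℝ} (hb : ∀ v, v ⬝ᵥ P *ᵥ v ≤ b * (v ⬝ᵥ v))
    (S : Matrix α β ℝ) : wFrobSq P S ≤ b * frobNorm S ^ 2 := by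
  rw [wFrobSq_eq_sum, frobNorm_sq, Finset.mul_sum]
  exact Finset.sum_le_sum fun i _ => hb _

/-- The bilinear form polarizing `wFrobSq P`. -/
def wFrobBilin (P : Matrix β β ℝ) (S S' : Matrix α β ℝ) : ℝ := ∑ i, S i ⬝ᵥ P *ᵥ S' i

theorem wFrobSq_add_smul {P : Matrix β β ℝ} (hP : P.PosSemidef) (S S' : Matrix α β ℝ) (x : ℝ) :
    wFrobSq P (S + x • S') = wFrobSq P S + 2 * x * wFrobBilin P S S' + x ^ 2 * wFrobSq P S' := by
  have hPt := transpose_eq_of_isHermitian hP.isHermitian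
  simp only [wFrobSq_eq_sum, wFrobBilin, Finset.mul_sum, ← Finset.sum_add_distrib]
  refine Finset.sum_congr rfl fun i _ => ?_
  have h1 : (S + x • S') i = S i + x • S' i := rfl
  rw [h1]
  simp only [Matrix.mulVec_add, Matrix.mulVec_smul, dotProduct_add, add_dotProduct,
    dotProduct_smul, smul_dotProduct, smul_eq_mul]
  rw [dotProduct_mulVec_comm hPt (S' i) (S i)]
  ring

/-- Cauchy–Schwarz from the discriminant of a nonnegative quadratic polynomial, which also covers
singular `P`. -/
theorem wFrobBilin_sq_le {P : Matrix β β ℝ} (hP : P.PosSemidef) (S S' : Matrix α β ℝ) :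
    wFrobBilin P S S' ^ 2 ≤ wFrobSq P S * wFrobSq P S' := by
  have h := discrim_le_zero (a := wFrobSq P S') (b := 2 * wFrobBilin P S S') (c := wFrobSq P S)
    fun x => by
      have h1 := wFrobSq_nonneg hP (S + x • S')
      rw [wFrobSq_add_smul hP] at h1
      linarith
  rw [discrim] at h
  linarith

theorem wFrobBilin_le {P : Matrix β β ℝ} (hP : P.PosSemidef) {b : ℝ} (hb0 : 0 ≤ b)
    (hb : ∀ v, v ⬝ᵥ P *ᵥ v ≤ b * (v ⬝ᵥ v)) (S S' : Matrix α β ℝ) :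
    wFrobBilin P S S' ≤ b * (frobNorm S * frobNorm S') := by
  refine le_of_sq_le_sq ((wFrobBilin_sq_le hP S S').trans ?_)
    (mul_nonneg hb0 (mul_nonneg (frobNorm_nonneg _) (frobNorm_nonneg _)))
  calc _ ≤ (b * frobNorm S ^ 2) * (b * frobNorm S' ^ 2) :=
        mul_le_mul (wFrobSq_le hb S) (wFrobSq_le hb S') (wFrobSq_nonneg hP _)
          (mul_nonneg hb0 (sq_nonneg _))
    _ = _ := by ring

/-- Used to change the comparator: on a bounded set, the price is linear in the displacement `S'`.
-/
theorem wFrobSq_add_le {P : Matrix β β ℝ} (hP : P.PosSemidef) {b : ℝ} (hb0 : 0 ≤ b)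
    (hb : ∀ v, v ⬝ᵥ P *ᵥ v ≤ b * (v ⬝ᵥ v)) (S S' : Matrix α β ℝ) :
    wFrobSq P (S + S') ≤ wFrobSq P S + b * (2 * frobNorm S + frobNorm S') * frobNorm S' := by
  have h := wFrobSq_add_smul hP S S' 1
  rw [one_smul] at h
  rw [h]
  have h1 := wFrobBilin_le hP hb0 hb S S'
  have h2 := wFrobSq_le hb S'
  linarith

/-- Weighted projections on a convex set do not increase the distance to points of the set. -/
theorem IsProjection.wFrobSq_sub_le {𝒮 : Set (Matrix α β ℝ)} (h𝒮 : Convex ℝ 𝒮)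
    {P : Matrix β β ℝ} (hP : P.PosSemidef) {Y S : Matrix α β ℝ} (h : IsProjection 𝒮 P Y S)
    {S' : Matrix α β ℝ} (hS' : S' ∈ 𝒮) : wFrobSq P (S - S') ≤ wFrobSq P (Y - S') := by
  -- First-order optimality. If `c < 0`, the step `x = -c / (q - c)` from `S` towards `S'` lies in
  -- `(0, 1]` and lowers the objective; the denominator is positive even when `q = 0`.
  have h0 : 0 ≤ wFrobBilin P (S - Y) (S' - S) := by
    by_contra hlt
    push Not at hlt
    set c := wFrobBilin P (S - Y) (S' - S)
    set q := wFrobSq P (S' - S)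
    have hq : 0 ≤ q := wFrobSq_nonneg hP _
    have key : ∀ x : ℝ, 0 ≤ x → x ≤ 1 → 0 ≤ 2 * x * c + x ^ 2 * q := by
      intro x hx0 hx1
      have hmem : S + x • (S' - S) ∈ 𝒮 := h𝒮.add_smul_sub_mem h.1 hS' ⟨hx0, hx1⟩
      have h1 := h.2 _ hmem
      rw [show S + x • (S' - S) - Y = (S - Y) + x • (S' - S) by abel, wFrobSq_add_smul hP] at h1
      linarith
    have hx : 0 < -c / (q - c) := div_pos (by linarith) (by linarith)
    have hqc : 0 < q - c := by linarith
    have hx1 : -c / (q - c) ≤ 1 := by rw [div_le_one hqc]; linarith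
    have h2 := key _ hx.le hx1
    have h3 : -c / (q - c) * (q - c) = -c := div_mul_cancel₀ _ hqc.ne'
    set x := -c / (q - c)
    have h4 : 0 ≤ x * (2 * c + x * q) := by linarith
    have h5 : 0 ≤ 2 * c + x * q := nonneg_of_mul_nonneg_right h4 hx
    nlinarith
  have h1 := wFrobSq_add_smul hP (S - S') (S - Y) (-1)
  have h2 : (S - S') + (-1 : ℝ) • (S - Y) = Y - S' := by
    rw [neg_one_smul]; abel
  have h3 : wFrobBilin P (S - S') (S - Y) = -wFrobBilin P (S - Y) (S' - S) := by
    have hPt := transpose_eq_of_isHermitian hP.isHermitian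
    simp only [wFrobBilin, ← Finset.sum_neg_distrib]
    refine Finset.sum_congr rfl fun i _ => ?_
    rw [dotProduct_mulVec_comm hPt, ← dotProduct_neg, ← Matrix.mulVec_neg]
    congr 2
    exact (neg_sub (S' i) (S i)).symm
  rw [h2, h3] at h1
  have h4 := wFrobSq_nonneg hP (S - Y)
  linarith

end Projection

/-! ### Recursive least squares with forgetting -/

section RecursiveLeastSquares

theorem vecMulVec_self_quadratic {β : Type} [Fintype β] (φ v : β → ℝ) :
    v ⬝ᵥ Matrix.vecMulVec φ φ *ᵥ v = (v ⬝ᵥ φ) ^ 2 := by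
  rw [Matrix.vecMulVec_mulVec, dotProduct_comm φ v]
  simp [sq]

variable {α β : Type} [Fintype α] [Fintype β] [DecidableEq β]

/-- Before projection, a row error `e` becomes `e - (e ⬝ᵥ φ) P⁻¹ φ`. Its `P`-square is `e ⬝ᵥ P *ᵥ e`
minus `(e ⬝ᵥ φ)²` times `2 - φ ⬝ᵥ P⁻¹ *ᵥ φ`, and the recursion for `P` returns one `(e ⬝ᵥ φ)²`.
Projecting onto `𝒮` can only bring the estimate closer to `S'`. -/
theorem rls_step {𝒮 : Set (Matrix α β ℝ)} (h𝒮 : Convex ℝ 𝒮) {P P₀ : Matrix β β ℝ} {φ : β → ℝ}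
    {γ : ℝ} (hP : P.PosDef) (hPP : P = γ • P₀ + Matrix.vecMulVec φ φ) {y : α → ℝ}
    {S S₀ S' : Matrix α β ℝ} (hS' : S' ∈ 𝒮) (hy : S' *ᵥ φ = y)
    (hS : IsProjection 𝒮 P (S₀ + Matrix.vecMulVec (y - S₀ *ᵥ φ) φ * P⁻¹) S) :
    (y - S₀ *ᵥ φ) ⬝ᵥ (y - S₀ *ᵥ φ) * (1 - φ ⬝ᵥ P⁻¹ *ᵥ φ)
      ≤ γ * wFrobSq P₀ (S₀ - S') - wFrobSq P (S - S') := by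
  have h1 := hS.wFrobSq_sub_le h𝒮 hP.posSemidef hS'
  have hPt := transpose_eq_of_isHermitian hP.isHermitian
  have hPit := transpose_eq_of_isHermitian hP.inv.isHermitian
  have hinv : P * P⁻¹ = 1 :=
    Matrix.mul_nonsing_inv _ ((Matrix.isUnit_iff_isUnit_det _).1 hP.isUnit)
  suffices h2 : wFrobSq P (S₀ + Matrix.vecMulVec (y - S₀ *ᵥ φ) φ * P⁻¹ - S')
      = γ * wFrobSq P₀ (S₀ - S')
        - (y - S₀ *ᵥ φ) ⬝ᵥ (y - S₀ *ᵥ φ) * (1 - φ ⬝ᵥ P⁻¹ *ᵥ φ) by linarith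
  have h3 : ∀ i, (S₀ + Matrix.vecMulVec (y - S₀ *ᵥ φ) φ * P⁻¹ - S') i
      = (S₀ - S') i + (-((S₀ - S') i ⬝ᵥ φ)) • P⁻¹ *ᵥ φ := by
    intro i
    have hrow : (Matrix.vecMulVec (y - S₀ *ᵥ φ) φ * P⁻¹) i = (y - S₀ *ᵥ φ) i • P⁻¹ *ᵥ φ := by
      rw [Matrix.vecMulVec_mul, ← Matrix.mulVec_transpose, hPit]
      rfl
    have hc : (y - S₀ *ᵥ φ) i = -((S₀ - S') i ⬝ᵥ φ) := by
      have : (S₀ - S') i ⬝ᵥ φ = ((S₀ - S') *ᵥ φ) i := rfl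
      rw [this, Matrix.sub_mulVec, hy]
      simp
    change S₀ i + (Matrix.vecMulVec (y - S₀ *ᵥ φ) φ * P⁻¹) i - S' i = S₀ i - S' i + _
    rw [hrow, hc]
    abel
  have h4 : (y - S₀ *ᵥ φ) ⬝ᵥ (y - S₀ *ᵥ φ) = ∑ i, ((S₀ - S') i ⬝ᵥ φ) ^ 2 := by
    rw [← hy, ← Matrix.sub_mulVec, dotProduct]
    refine Finset.sum_congr rfl fun i _ => ?_
    have : ((S' - S₀) *ᵥ φ) i = -((S₀ - S') i ⬝ᵥ φ) := by
      rw [← neg_sub S₀ S', Matrix.neg_mulVec]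
      rfl
    rw [this]
    ring
  rw [h4, wFrobSq_eq_sum, wFrobSq_eq_sum, Finset.mul_sum, Finset.sum_mul, ← Finset.sum_sub_distrib]
  refine Finset.sum_congr rfl fun i _ => ?_
  rw [h3]
  generalize (S₀ - S') i = e
  have h5 : P *ᵥ P⁻¹ *ᵥ φ = φ := by rw [Matrix.mulVec_mulVec, hinv, Matrix.one_mulVec]
  have h6 : e ⬝ᵥ P *ᵥ e = γ * (e ⬝ᵥ P₀ *ᵥ e) + (e ⬝ᵥ φ) ^ 2 := by
    rw [hPP, Matrix.add_mulVec, dotProduct_add, vecMulVec_self_quadratic, Matrix.smul_mulVec,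
      dotProduct_smul, smul_eq_mul]
  simp only [Matrix.mulVec_add, Matrix.mulVec_smul, h5, dotProduct_add, add_dotProduct,
    dotProduct_smul, smul_dotProduct, smul_eq_mul]
  rw [dotProduct_mulVec_comm hPt (P⁻¹ *ᵥ φ) e, h5, h6, dotProduct_comm (P⁻¹ *ᵥ φ) φ]
  ring

/-- The elliptical potential inequality. -/
theorem leverage_le_log_det {P P₀ : Matrix β β ℝ} {φ : β → ℝ} {γ : ℝ} (hγ : 0 < γ)
    (hP₀ : P₀.PosDef) (hP : P.PosDef) (hPP : P = γ • P₀ + Matrix.vecMulVec φ φ) :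
    0 ≤ φ ⬝ᵥ P⁻¹ *ᵥ φ ∧ φ ⬝ᵥ P⁻¹ *ᵥ φ
      ≤ Real.log P.det - Real.log P₀.det - Fintype.card β * Real.log γ := by
  have h0 : 0 ≤ φ ⬝ᵥ P⁻¹ *ᵥ φ := by simpa using hP.inv.posSemidef.dotProduct_mulVec_nonneg φ
  refine ⟨h0, ?_⟩
  -- Read as a rank-one downdate of `P`, the recursion gives `γ ^ d det P₀ = det P (1 - h)` for the
  -- leverage `h`, by the matrix determinant lemma. Then `h ≤ -log (1 - h)`.
  have hG : γ • P₀ = P + Matrix.replicateCol Unit (-φ) * Matrix.replicateRow Unit φ := by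
    rw [hPP, ← Matrix.vecMulVec_eq, Matrix.neg_vecMulVec]
    abel
  have hdet : γ ^ Fintype.card β * P₀.det = P.det * (1 - φ ⬝ᵥ P⁻¹ *ᵥ φ) := by
    rw [← Matrix.det_smul, hG, Matrix.det_add_replicateCol_mul_replicateRow
      ((Matrix.isUnit_iff_isUnit_det _).1 hP.isUnit)]
    rw [Matrix.det_unique (n := Unit), Matrix.mul_assoc, ← Matrix.replicateCol_mulVec, Matrix.add_apply,
      Matrix.one_apply_eq, Matrix.replicateRow_mul_replicateCol_apply, Matrix.mulVec_neg,
      dotProduct_neg, sub_eq_add_neg]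
  have hl : 0 < γ ^ Fintype.card β * P₀.det := mul_pos (pow_pos hγ _) hP₀.det_pos
  have h1 : 0 < 1 - φ ⬝ᵥ P⁻¹ *ᵥ φ := by
    rw [hdet] at hl
    exact pos_of_mul_pos_right hl hP.det_pos.le
  have h2 := congrArg Real.log hdet
  rw [Real.log_mul (pow_pos hγ _).ne' hP₀.det_pos.ne', Real.log_mul hP.det_pos.ne' h1.ne',
    Real.log_pow] at h2
  have h3 := Real.log_le_sub_one_of_pos h1
  linarith

theorem sum_range_le_of_split {N k : ℕ} {g f : ℕ → ℝ} {c : ℝ} (hc : 0 ≤ c)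
    (h1 : ∀ s, s < k → s < N → g s ≤ c) (h2 : ∀ s, k ≤ s → s < N → g s ≤ f s) :
    ∑ s ∈ Finset.range N, g s ≤ k * c + ∑ s ∈ Finset.Ico k N, f s := by
  rw [← Finset.sum_filter_add_sum_filter_not (Finset.range N) (fun s => s < k)]
  refine add_le_add ?_ ?_
  · have h3 : (Finset.range N).filter (fun s => s < k) ⊆ Finset.range k := fun s hs =>
      Finset.mem_range.2 (Finset.mem_filter.1 hs).2
    have h4 := Finset.card_le_card h3
    rw [Finset.card_range] at h4
    calc _ ≤ ∑ s ∈ (Finset.range N).filter (fun s => s < k), c :=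
          Finset.sum_le_sum fun s hs => h1 s (Finset.mem_filter.1 hs).2
            (Finset.mem_range.1 (Finset.mem_filter.1 hs).1)
      _ = ((Finset.range N).filter (fun s => s < k)).card * c := by simp
      _ ≤ k * c := mul_le_mul_of_nonneg_right (by exact_mod_cast h4) hc
  · have h3 : (Finset.range N).filter (fun s => ¬ s < k) = Finset.Ico k N := by
      ext s
      simp only [Finset.mem_filter, Finset.mem_range, Finset.mem_Ico]
      omega
    rw [h3]
    exact Finset.sum_le_sum fun s hs => h2 s (Finset.mem_Ico.1 hs).1 (Finset.mem_Ico.1 hs).2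

theorem sum_Ico_shift {M : Type*} [AddCommMonoid M] {k T : ℕ} (f : ℕ → M) :
    ∑ t ∈ Finset.Ico k T, f (t - k) = ∑ s ∈ Finset.range (T - k), f s := by
  rw [Finset.sum_Ico_eq_sum_range]
  simp

theorem sum_stride_telescope {k T : ℕ} (hk : k ≤ T) (ℓ : ℕ → ℝ) :
    ∑ t ∈ Finset.Ico k T, (ℓ t - ℓ (t - k))
      = ∑ t ∈ Finset.Ico (T - k) T, ℓ t - ∑ t ∈ Finset.range k, ℓ t := by
  rw [Finset.sum_sub_distrib, sum_Ico_shift]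
  have h1 := Finset.sum_range_add_sum_Ico ℓ hk
  have h2 := Finset.sum_range_add_sum_Ico ℓ (Nat.sub_le T k)
  linarith

/-- Tracking error of `k` interleaved recursive least squares learners with forgetting. -/
theorem rls_tracking {𝒮 : Set (Matrix α β ℝ)} (h𝒮 : Convex ℝ 𝒮) {k T : ℕ} (hkT : k < T)
    {γ lo up b F E : ℝ} (hγ : 0 < γ) (hγ1 : γ ≤ 1) (hlo : 0 < lo) (hb : 0 < b)
    {φ : ℕ → β → ℝ} {y : ℕ → α → ℝ} {P : ℕ → Matrix β β ℝ} {Sh Ss : ℕ → Matrix α β ℝ}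
    (hF : ∀ S ∈ 𝒮, ∀ S' ∈ 𝒮, frobNorm (S - S') ≤ F)
    (hE : ∀ S ∈ 𝒮, ∀ t, t + k < T → (y (t + k) - S *ᵥ φ t) ⬝ᵥ (y (t + k) - S *ᵥ φ t) ≤ E)
    (hP : ∀ t, t < T → (P t).PosDef) (hPb : ∀ t, t < T → ∀ v, v ⬝ᵥ P t *ᵥ v ≤ b * (v ⬝ᵥ v))
    (hlow : ∀ t, t < k → ∀ v, lo * (v ⬝ᵥ v) ≤ v ⬝ᵥ P t *ᵥ v)
    (hup : ∀ t, t < k → ∀ v, v ⬝ᵥ P t *ᵥ v ≤ up * (v ⬝ᵥ v)) (hup0 : 0 ≤ up)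
    (hPP : ∀ t, t + k < T → P (t + k) = γ • P t + Matrix.vecMulVec (φ t) (φ t))
    (hSh : ∀ t, t < T → Sh t ∈ 𝒮) (hSs : ∀ t, t + k < T → Ss t ∈ 𝒮)
    (hy : ∀ t, t + k < T → Ss t *ᵥ φ t = y (t + k))
    (hproj : ∀ t, t + k < T → IsProjection 𝒮 (P (t + k))
      (Sh t + Matrix.vecMulVec (y (t + k) - Sh t *ᵥ φ t) (φ t) * (P (t + k))⁻¹) (Sh (t + k))) :
    ∑ t ∈ Finset.range (T - k), (y (t + k) - Sh t *ᵥ φ t) ⬝ᵥ (y (t + k) - Sh t *ᵥ φ t)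
      ≤ k * (up * F ^ 2)
        + b * (3 * F) * ∑ s ∈ Finset.range (T - 2 * k), frobNorm (Ss (s + k) - Ss s)
        + E * (k * (Fintype.card β * (Real.log b - Real.log lo))
          - T * (Fintype.card β * Real.log γ)) := by
  set e : ℕ → ℝ := fun t => (y (t + k) - Sh t *ᵥ φ t) ⬝ᵥ (y (t + k) - Sh t *ᵥ φ t) with he
  set h : ℕ → ℝ := fun t => φ t ⬝ᵥ (P (t + k))⁻¹ *ᵥ φ t with hh
  set a : ℕ → ℝ := fun t => wFrobSq (P (t + k)) (Sh (t + k) - Ss t) with ha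
  set g : ℕ → ℝ := fun t => wFrobSq (P t) (Sh t - Ss t) with hg
  have hlt : ∀ t ∈ Finset.range (T - k), t + k < T := fun t ht => by
    have := Finset.mem_range.1 ht; omega
  have hF0 : 0 ≤ F := (frobNorm_nonneg _).trans
    (hF _ (hSh 0 (by omega)) _ (hSh 0 (by omega)))
  have hE0 : 0 ≤ E := (dotProduct_self_nonneg' _).trans (hE _ (hSh 0 (by omega)) 0 (by omega))
  -- The leverage part of the error is bounded crudely through `E`; the remainder is a decrease from
  -- `g` to `a`, with the factor `γ ≤ 1` dropped.
  have hstep : ∀ t ∈ Finset.range (T - k), e t ≤ E * h t + (g t - a t) := by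
    intro t ht
    have ht' := hlt t ht
    have h1 := rls_step h𝒮 (hP _ ht') (hPP t ht') (hSs t ht') (hy t ht') (hproj t ht')
    have h2 := (leverage_le_log_det hγ (hP t (by omega)) (hP _ ht') (hPP t ht')).1
    have h3 := mul_le_mul_of_nonneg_right (hE _ (hSh t (by omega)) t ht') h2
    have h4 : γ * g t ≤ g t :=
      mul_le_of_le_one_left (wFrobSq_nonneg (hP t (by omega)).posSemidef _) hγ1
    simp only [he, hh, ha, hg] at *
    linarith
  -- The log-determinants telescope with stride `k`: the last `k` are bounded above through `b`, the
  -- first `k` below through `lo`, and forgetting adds `-d log γ` per step.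
  have hsum_h : ∑ t ∈ Finset.range (T - k), h t
      ≤ k * (Fintype.card β * (Real.log b - Real.log lo)) - T * (Fintype.card β * Real.log γ) := by
    have h1 : ∀ t ∈ Finset.range (T - k), h t ≤ (Real.log (P (t + k)).det - Real.log (P t).det)
        - Fintype.card β * Real.log γ := fun t ht =>
      (leverage_le_log_det hγ (hP t (by have := hlt t ht; omega)) (hP _ (hlt t ht))
        (hPP t (hlt t ht))).2
    have h2 := Finset.sum_le_sum h1
    rw [Finset.sum_sub_distrib] at h2
    have h3 := sum_stride_telescope hkT.le (fun t => Real.log (P t).det)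
    have h4 := sum_Ico_shift (k := k) (T := T)
      (fun t => Real.log (P (t + k)).det - Real.log (P t).det)
    have h5 : ∑ t ∈ Finset.Ico k T, (Real.log (P (t - k + k)).det - Real.log (P (t - k)).det)
        = ∑ t ∈ Finset.Ico k T, (Real.log (P t).det - Real.log (P (t - k)).det) := by
      refine Finset.sum_congr rfl fun t ht => ?_
      rw [Nat.sub_add_cancel (Finset.mem_Ico.1 ht).1]
    have h6 : ∑ t ∈ Finset.Ico (T - k) T, Real.log (P t).det
        ≤ k * (Fintype.card β * Real.log b) := by
      calc _ ≤ ∑ t ∈ Finset.Ico (T - k) T, Fintype.card β * Real.log b := by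
            refine Finset.sum_le_sum fun t ht => ?_
            have ht' := (Finset.mem_Ico.1 ht).2
            rw [← Real.log_pow]
            exact Real.log_le_log (hP t ht').det_pos (det_le_pow (hP t ht') (hPb t ht'))
        _ = _ := by simp [Nat.sub_sub_self hkT.le]
    have h7 : k * (Fintype.card β * Real.log lo)
        ≤ ∑ t ∈ Finset.range k, Real.log (P t).det := by
      calc _ = ∑ t ∈ Finset.range k, Fintype.card β * Real.log lo := by simp
        _ ≤ _ := by
            refine Finset.sum_le_sum fun t ht => ?_
            have ht' := Finset.mem_range.1 ht
            rw [← Real.log_pow]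
            exact Real.log_le_log (pow_pos hlo _)
              (pow_le_det (hP t (by omega)) hlo.le (hlow t ht'))
    have h8 : ∑ t ∈ Finset.range (T - k), (Fintype.card β * Real.log γ)
        ≥ T * (Fintype.card β * Real.log γ) := by
      rw [Finset.sum_const, Finset.card_range, nsmul_eq_mul]
      have hl : Real.log γ ≤ 0 := Real.log_nonpos hγ.le hγ1
      have hT : ((T - k : ℕ) : ℝ) ≤ T := by exact_mod_cast Nat.sub_le T k
      exact mul_le_mul_of_nonpos_right hT
        (mul_nonpos_of_nonneg_of_nonpos (by positivity) hl)
    linarith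
  -- `g t` and `a (t - k)` share the matrix `P t` and the estimate `Sh t` and differ only in the
  -- comparator. Moving it costs at most `b (2F + F)` times its displacement; the first `k` terms
  -- have no predecessor and are bounded directly.
  have hsum_g : ∑ t ∈ Finset.range (T - k), g t ≤ k * (up * F ^ 2)
      + ∑ t ∈ Finset.Ico k (T - k), (a (t - k) + b * (3 * F) * frobNorm (Ss t - Ss (t - k))) := by
    refine sum_range_le_of_split (by positivity) (fun t ht1 ht2 => ?_) (fun t ht1 ht2 => ?_)
    · refine (wFrobSq_le (hup t ht1) _).trans (mul_le_mul_of_nonneg_left ?_ hup0)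
      exact pow_le_pow_left₀ (frobNorm_nonneg _)
        (hF _ (hSh t (by omega)) _ (hSs t (by omega))) 2
    · have h1 := wFrobSq_add_le (hP t (by omega)).posSemidef hb.le (hPb t (by omega))
        (Sh t - Ss (t - k)) (Ss (t - k) - Ss t)
      have h2 := hF _ (hSh t (by omega)) _ (hSs (t - k) (by omega))
      have h3 := hF _ (hSs (t - k) (by omega)) _ (hSs t (by omega))
      have h4 : frobNorm (Ss (t - k) - Ss t) = frobNorm (Ss t - Ss (t - k)) := by
        simp only [frobNorm_eq_norm]
        open scoped Matrix.Norms.Frobenius in exact norm_sub_rev _ _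
      rw [sub_add_sub_cancel, h4] at h1
      rw [h4] at h3
      simp only [hg, ha, Nat.sub_add_cancel ht1]
      refine h1.trans (add_le_add le_rfl (mul_le_mul_of_nonneg_right
        (mul_le_mul_of_nonneg_left (by linarith) hb.le) (frobNorm_nonneg _)))
  -- The terms of `a` left over after telescoping are nonnegative and are discarded.
  have hsum_a : ∑ t ∈ Finset.Ico k (T - k), a (t - k) ≤ ∑ t ∈ Finset.range (T - k), a t := by
    rw [sum_Ico_shift]
    exact Finset.sum_le_sum_of_subset_of_nonneg
      (Finset.range_mono (Nat.sub_le _ _)) fun t ht _ =>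
        wFrobSq_nonneg (hP _ (hlt t ht)).posSemidef _
  have hsum_D : ∑ t ∈ Finset.Ico k (T - k), frobNorm (Ss t - Ss (t - k))
      = ∑ s ∈ Finset.range (T - 2 * k), frobNorm (Ss (s + k) - Ss s) := by
    rw [Finset.sum_Ico_eq_sum_range, show T - k - k = T - 2 * k by omega]
    refine Finset.sum_congr rfl fun s _ => ?_
    rw [Nat.add_sub_cancel_left, add_comm]
  have h1 := Finset.sum_le_sum hstep
  rw [Finset.sum_add_distrib, Finset.sum_sub_distrib, ← Finset.mul_sum] at h1
  rw [Finset.sum_add_distrib, ← Finset.mul_sum, hsum_D] at hsum_g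
  have h2 := mul_le_mul_of_nonneg_left hsum_h hE0
  linarith

end RecursiveLeastSquares

/-! ### Multi-step prediction errors -/

section Prediction

variable {n p : ℕ} {T W : ℕ} {M D ε γ : ℝ} {r : ℤ → Fin n → ℝ}
  {S : ℕ → Matrix (Fin n) (Fin p × Fin n) ℝ}
  {Shat : ℕ → ℤ → Matrix (Fin n) (Fin p × Fin n) ℝ}
  {P : ℕ → ℤ → Matrix (Fin p × Fin n) (Fin p × Fin n) ℝ}

theorem dotProduct_sq_le {β : Type} [Fintype β] (v w : β → ℝ) :
    (v ⬝ᵥ w) ^ 2 ≤ (w ⬝ᵥ w) * (v ⬝ᵥ v) := by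
  have := Finset.sum_mul_sq_le_sq_mul_sq Finset.univ v w
  simp only [dotProduct, ← sq]
  linarith

theorem frobNorm_le_of_mem {S : Matrix (Fin n) (Fin p × Fin n) ℝ} (hM : 0 ≤ M)
    (hS : S ∈ boundedSet n p M) : frobNorm S ≤ Real.sqrt n * M := by
  refine le_of_sq_le_sq ?_ (by positivity)
  rw [frobNorm_sq, mul_pow, Real.sq_sqrt (by positivity)]
  refine (Finset.sum_le_sum fun i _ => dotProduct_row_self_le hS i).trans ?_
  simp

theorem frobNorm_sub_le_of_mem {S S' : Matrix (Fin n) (Fin p × Fin n) ℝ} (hM : 0 ≤ M)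
    (hS : S ∈ boundedSet n p M) (hS' : S' ∈ boundedSet n p M) :
    frobNorm (S - S') ≤ 2 * (Real.sqrt n * M) := by
  have h1 := frobNorm_le_of_mem hM hS
  have h2 := frobNorm_le_of_mem hM hS'
  have h3 : frobNorm (S - S') ≤ frobNorm S + frobNorm S' := by
    simp only [frobNorm_eq_norm]
    open scoped Matrix.Norms.Frobenius in exact norm_sub_le S S'
  linarith

theorem sq_mulVec_sub_le {S S' : Matrix (Fin n) (Fin p × Fin n) ℝ} {b : ℝ}
    (hS : S ∈ boundedSet n p M) (hS' : S' ∈ boundedSet n p M) {v : Fin p × Fin n → ℝ}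
    (hv : v ⬝ᵥ v ≤ b) : (S *ᵥ v - S' *ᵥ v) ⬝ᵥ (S *ᵥ v - S' *ᵥ v) ≤ 4 * M ^ 2 * b := by
  have h : ∀ S ∈ boundedSet n p M, euclNorm (S *ᵥ v) ≤ M * euclNorm v := fun S hS =>
    (euclNorm_mulVec_le S v).trans (mul_le_mul_of_nonneg_right hS (euclNorm_nonneg v))
  rw [← euclNorm_sq]
  calc _ ≤ (2 * M * euclNorm v) ^ 2 := by
        refine pow_le_pow_left₀ (euclNorm_nonneg _) ((euclNorm_sub_le _ _).trans ?_) 2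
        have h1 := h S hS
        have h2 := h S' hS'
        linarith
    _ = 4 * M ^ 2 * (v ⬝ᵥ v) := by rw [← euclNorm_sq]; ring
    _ ≤ _ := by gcongr

theorem IsRLS.mem (h : IsRLS T W M ε γ r Shat P) {k : ℕ} (hk : 1 ≤ k) (hkW : k ≤ W) {t : ℕ}
    (ht : t < T) : Shat k t ∈ boundedSet n p M := by
  by_cases htk : (t : ℤ) ≤ (k : ℤ) - 2
  · exact h.init_S k hk hkW t (by omega) htk
  · exact (h.update_S k hk hkW t (by omega) (by omega)).1

theorem IsRLS.prediction_error_le (hT : IsTarget T M D r S) (h : IsRLS T W M ε γ r Shat P)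
    (hp : 0 < p) {k : ℕ} (hk : 1 ≤ k) (hkW : k ≤ W) {t : ℕ} (htk : t + k ≤ T) :
    (r (t + k : ℕ) - Shat k t *ᵥ regressor p r t) ⬝ᵥ (r (t + k : ℕ) - Shat k t *ᵥ regressor p r t)
      ≤ 4 * M ^ 2 * (p * D ^ 2) := by
  rw [← multiStep_mulVec_regressor hp hT t k htk]
  exact sq_mulVec_sub_le (hT.multiStep_mem t k hk htk) (h.mem hk hkW (by omega))
    (euclNorm_regressor_sq_le hT t (by omega))

theorem IsRLS.update_P' (h : IsRLS T W M ε γ r Shat P) {k : ℕ} (hk : 1 ≤ k) (hkW : k ≤ W) {t : ℕ}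
    (ht : t + k < T) : P k (t + k : ℕ)
      = γ • P k t + Matrix.vecMulVec (regressor p r t) (regressor p r t) := by
  have := h.update_P k hk hkW (t + k : ℕ) (by omega) (by omega)
  rwa [show ((t + k : ℕ) : ℤ) - k = t by push_cast; ring] at this

theorem smul_add_vecMulVec_posDef {β : Type} [Fintype β] [DecidableEq β] {P : Matrix β β ℝ}
    (hP : P.PosDef) (hγ : 0 < γ) (φ : β → ℝ) : (γ • P + Matrix.vecMulVec φ φ).PosDef := by
  refine (hP.smul hγ).add_posSemidef ?_
  simpa using Matrix.posSemidef_vecMulVec_self_star φ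

theorem smul_add_vecMulVec_quadratic {β : Type} [Fintype β] (P : Matrix β β ℝ) (φ v : β → ℝ) :
    v ⬝ᵥ (γ • P + Matrix.vecMulVec φ φ) *ᵥ v = γ * (v ⬝ᵥ P *ᵥ v) + (v ⬝ᵥ φ) ^ 2 := by
  rw [Matrix.add_mulVec, dotProduct_add, vecMulVec_self_quadratic, Matrix.smul_mulVec,
    dotProduct_smul, smul_eq_mul]

/-- These matrices start the `k` learners. Since the initial times are `-1, …, k - 2`, the matrix at
`t = k - 1` already carries one update; this is why `ε / 2` and `p D²` appear in the bounds. -/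
theorem IsRLS.base_P (hT : IsTarget T M D r S) (h : IsRLS T W M ε γ r Shat P) (hε : 0 < ε)
    (hγ : 1 / 2 ≤ γ) (hγ1 : γ ≤ 1) {k : ℕ} (hk : 1 ≤ k) (hkW : k ≤ W) {t : ℕ} (htk : t < k)
    (ht : t < T) : (P k t).PosDef ∧ ∀ v, ε / 2 * (v ⬝ᵥ v) ≤ v ⬝ᵥ P k t *ᵥ v ∧
      v ⬝ᵥ P k t *ᵥ v ≤ (ε + p * D ^ 2) * (v ⬝ᵥ v) := by
  have hone : ((ε • 1 : Matrix (Fin p × Fin n) (Fin p × Fin n) ℝ)).PosDef :=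
    Matrix.PosDef.one.smul hε
  have hquad : ∀ v : Fin p × Fin n → ℝ,
      v ⬝ᵥ (ε • 1 : Matrix (Fin p × Fin n) (Fin p × Fin n) ℝ) *ᵥ v = ε * (v ⬝ᵥ v) := fun v => by
    rw [Matrix.smul_mulVec, Matrix.one_mulVec, dotProduct_smul, smul_eq_mul]
  by_cases htk' : (t : ℤ) ≤ (k : ℤ) - 2
  · rw [h.init_P k hk hkW t (by omega) htk']
    refine ⟨hone, fun v => ?_⟩
    rw [hquad]
    have h1 := dotProduct_self_nonneg' v
    have h2 : 0 ≤ (p * D ^ 2) * (v ⬝ᵥ v) := by positivity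
    constructor <;> nlinarith
  · have htk2 : (t : ℤ) - k = -1 := by omega
    rw [h.update_P k hk hkW t (by omega) (by omega), htk2,
      h.init_P k hk hkW (-1) le_rfl (by omega)]
    refine ⟨smul_add_vecMulVec_posDef hone (by linarith) _, fun v => ?_⟩
    rw [smul_add_vecMulVec_quadratic, hquad]
    have h1 := dotProduct_self_nonneg' v
    have h2 := dotProduct_sq_le v (regressor p r (-1))
    have h3 := mul_le_mul_of_nonneg_right
      (euclNorm_regressor_sq_le (p := p) hT (-1) (by omega)) h1
    have h4 : 0 ≤ ε * (v ⬝ᵥ v) := by positivity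
    constructor <;> nlinarith [sq_nonneg (v ⬝ᵥ regressor p r (-1))]

/-- With `q = p D² / (1 - γ)` the bound is preserved by the recursion: `γ (ε + q) + (1 - γ) q ≤ ε +
q`. -/
theorem IsRLS.bound_P (hT : IsTarget T M D r S) (h : IsRLS T W M ε γ r Shat P) (hε : 0 < ε)
    (hγ : 1 / 2 ≤ γ) (hγ1 : γ < 1) {k : ℕ} (hk : 1 ≤ k) (hkW : k ≤ W) (t : ℕ)
    (ht : t < T) : (P k t).PosDef ∧ ∀ v,
      v ⬝ᵥ P k t *ᵥ v ≤ (ε + p * D ^ 2 / (1 - γ)) * (v ⬝ᵥ v) := by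
  induction t using Nat.strong_induction_on with
  | _ t ih =>
    have hη : 0 < 1 - γ := by linarith
    by_cases htk : t < k
    · obtain ⟨h1, h2⟩ := h.base_P hT hε hγ hγ1.le hk hkW htk ht
      refine ⟨h1, fun v => (h2 v).2.trans
        (mul_le_mul_of_nonneg_right ?_ (dotProduct_self_nonneg' v))⟩
      have : p * D ^ 2 ≤ p * D ^ 2 / (1 - γ) := by
        rw [le_div_iff₀ hη]
        exact mul_le_of_le_one_right (by positivity) (by linarith)
      linarith
    · obtain ⟨s, rfl⟩ : ∃ s, t = s + k := ⟨t - k, by omega⟩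
      obtain ⟨h1, h2⟩ := ih s (by omega) (by omega)
      rw [h.update_P' hk hkW ht]
      refine ⟨smul_add_vecMulVec_posDef h1 (by linarith) _, fun v => ?_⟩
      rw [smul_add_vecMulVec_quadratic]
      have h3 := dotProduct_sq_le v (regressor p r s)
      have h4 := mul_le_mul_of_nonneg_right
        (euclNorm_regressor_sq_le (p := p) hT s (by omega)) (dotProduct_self_nonneg' v)
      have h5 := mul_le_mul_of_nonneg_left (h2 v) (show 0 ≤ γ by linarith)
      have h6 : (p * D ^ 2 / (1 - γ)) * (1 - γ) = p * D ^ 2 := div_mul_cancel₀ _ hη.ne'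
      set q := p * D ^ 2 / (1 - γ)
      have h7 : 0 ≤ ε * (1 - γ) * (v ⬝ᵥ v) :=
        mul_nonneg (by positivity) (dotProduct_self_nonneg' v)
      rw [← h6] at h4
      linarith

theorem IsRLS.sum_prediction_error_le (hT : IsTarget T M D r S)
    (h : IsRLS T W M ε γ r Shat P) (hp : 0 < p) (hM : 0 ≤ M) (hε : 0 < ε)
    (hγ : 1 / 2 ≤ γ) (hγ1 : γ < 1) {k : ℕ} (hk : 1 ≤ k) (hkW : k ≤ W) (hkT : k < T) :
    ∑ t ∈ Finset.range (T - k), (r (t + k : ℕ) - Shat k t *ᵥ regressor p r t)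
        ⬝ᵥ (r (t + k : ℕ) - Shat k t *ᵥ regressor p r t)
      ≤ k * ((ε + p * D ^ 2) * (2 * (Real.sqrt n * M)) ^ 2)
        + (ε + p * D ^ 2 / (1 - γ)) * (3 * (2 * (Real.sqrt n * M))) *
          (frobNorm (outputMatrix n p) * frobNorm (outputMatrix n p)ᵀ * (p * n * (M ^ 2 + 1))
            * (k ^ 2 * pathLength T S))
        + 4 * M ^ 2 * (p * D ^ 2) * (k * (((p * n : ℕ) : ℝ)
            * (Real.log (ε + p * D ^ 2 / (1 - γ)) - Real.log (ε / 2)))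
          - T * (((p * n : ℕ) : ℝ) * Real.log γ)) := by
  have hη : 0 < 1 - γ := by linarith
  have hb : 0 < ε + p * D ^ 2 / (1 - γ) := by positivity
  have hcast : ∀ t : ℕ, ((t + k : ℕ) : ℤ) - k = t := fun t => by push_cast; ring
  have key := rls_tracking (convex_boundedSet n p M) hkT (γ := γ) (lo := ε / 2)
    (up := ε + p * D ^ 2) (b := ε + p * D ^ 2 / (1 - γ)) (F := 2 * (Real.sqrt n * M))
    (E := 4 * M ^ 2 * (p * D ^ 2)) (by linarith) hγ1.le (by positivity) hb
    (φ := fun t => regressor p r t) (y := fun t => r t) (P := fun t => P k t)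
    (Sh := fun t => Shat k t) (Ss := fun t => multiStep S t k)
    (fun S hS S' hS' => frobNorm_sub_le_of_mem hM hS hS')
    (fun S' hS' t ht => by
      rw [← multiStep_mulVec_regressor hp hT t k ht.le]
      exact sq_mulVec_sub_le (hT.multiStep_mem t k hk ht.le) hS'
        (euclNorm_regressor_sq_le hT t (by omega)))
    (fun t ht => (h.bound_P hT hε hγ hγ1 hk hkW t ht).1)
    (fun t ht => (h.bound_P hT hε hγ hγ1 hk hkW t ht).2)
    (fun t ht v => ((h.base_P hT hε hγ hγ1.le hk hkW ht (by omega)).2 v).1)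
    (fun t ht v => ((h.base_P hT hε hγ hγ1.le hk hkW ht (by omega)).2 v).2)
    (by positivity)
    (fun t ht => h.update_P' hk hkW ht)
    (fun t ht => h.mem hk hkW ht)
    (fun t ht => hT.multiStep_mem t k hk ht.le)
    (fun t ht => multiStep_mulVec_regressor hp hT t k ht.le)
    (fun t ht => by
      have := h.update_S k hk hkW (t + k : ℕ) (by omega) (by omega)
      rwa [hcast] at this)
  have hd : Fintype.card (Fin p × Fin n) = p * n := by simp
  rw [hd] at key
  refine key.trans (add_le_add (add_le_add le_rfl (mul_le_mul_of_nonneg_left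
    (sum_frobNorm_multiStep_sub_le hp hT k) (by positivity))) le_rfl)

/-- The scale `max {√(T V), log T}` of the regret bound. -/
def regretScale (T : ℕ) (V : ℝ) : ℝ := max (Real.sqrt (T * V)) (Real.log T)

theorem log_le_regretScale (T : ℕ) (V : ℝ) : Real.log T ≤ regretScale T V := le_max_right _ _

theorem half_le_regretScale {T : ℕ} (hT : 2 ≤ T) (V : ℝ) : 1 / 2 ≤ regretScale T V := by
  have h1 : Real.log 2 ≤ Real.log T :=
    Real.log_le_log two_pos (by exact_mod_cast hT)
  have h2 := Real.log_two_gt_d9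
  have h3 := log_le_regretScale T V
  linarith

theorem mul_le_regretScale_sq {V : ℝ} (hV : 0 ≤ V) : T * V ≤ regretScale T V ^ 2 := by
  rw [← Real.sq_sqrt (show 0 ≤ T * V by positivity)]
  exact pow_le_pow_left₀ (Real.sqrt_nonneg _) (le_max_left _ _) 2

/-- The reason for the choice of `γ`: `1 - γ` is proportional to `G / T`, so forgetting costs `T (1
- γ) ~ G` and drift costs `V / (1 - γ) ~ T V / G ≤ G`. -/
theorem forgettingFactor_eq {T : ℕ} (hT : 2 ≤ T) {V : ℝ} (hM : 0 < M) :
    (1 - forgettingFactor M T V) * (T * (2 * Real.sqrt M)) = regretScale T V := by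
  have hT0 : (0 : ℝ) < T := by exact_mod_cast (by omega : 0 < T)
  have hlog : 0 ≤ Real.log T := Real.log_nonneg (by exact_mod_cast (by omega : 1 ≤ T))
  rw [forgettingFactor, sub_sub_cancel]
  have h1 : (T : ℝ) * (2 * Real.sqrt M) = Real.sqrt (T ^ 2 * (4 * M)) := by
    rw [Real.sqrt_mul (by positivity), Real.sqrt_sq hT0.le, Real.sqrt_mul (by norm_num),
      show (4 : ℝ) = 2 ^ 2 by norm_num, Real.sqrt_sq (by norm_num)]
  rw [h1, ← Real.sqrt_mul' _ (by positivity)]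
  have h2 : max V (Real.log T ^ 2 / T) / (4 * M * T) * (T ^ 2 * (4 * M))
      = max (T * V) (Real.log T ^ 2) := by
    have h3 : max V (Real.log T ^ 2 / T) / (4 * M * T) * (T ^ 2 * (4 * M))
        = T * max V (Real.log T ^ 2 / T) := by
      field_simp
    rw [h3, mul_max_of_nonneg _ _ hT0.le]
    congr 1
    field_simp
  rw [h2, regretScale]
  have hmono : Monotone Real.sqrt := fun _ _ => Real.sqrt_le_sqrt
  rw [hmono.map_max, Real.sqrt_sq hlog]

theorem pathLength_nonneg (T : ℕ) (S : ℕ → Matrix (Fin n) (Fin p × Fin n) ℝ) :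
    0 ≤ pathLength T S := Finset.sum_nonneg fun _ _ => frobNorm_nonneg _

/-- The terms of the tracking bound are of the order `k² G`. -/
theorem tracking_terms_le {ε b F c E d s G T V k γ : ℝ} (hε : 0 < ε) (hb0 : 0 ≤ b) (hF0 : 0 ≤ F)
    (hc0 : 0 ≤ c) (hE0 : 0 ≤ E) (hd0 : 0 ≤ d) (hs0 : 0 < s) (hG : 1 / 2 ≤ G) (hT1 : 1 ≤ T)
    (hV : 0 ≤ V) (hk1 : 1 ≤ k) (hγ : 1 / 2 ≤ γ) (hγ1 : γ < 1) (hηG : (1 - γ) * (T * s) = G)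
    (hVG : T * V ≤ G ^ 2) (hlogT : Real.log T ≤ G) :
    k * ((ε + b) * F ^ 2) + (ε + b / (1 - γ)) * (3 * F) * (c * (k ^ 2 * V))
        + E * (k * (d * (Real.log (ε + b / (1 - γ)) - Real.log (ε / 2)))
          - T * (d * Real.log γ)) + E
      ≤ (2 * ((ε + b) * F ^ 2) + 3 * F * c * (ε * s + b * s)
        + E * (d * (2 * |Real.log (ε + 2 * s * b)| + 1 + 2 * |Real.log (ε / 2)|) + 2 * d / s)
        + 2 * E) * (k ^ 2 * G) := by
  set l := 2 * |Real.log (ε + 2 * s * b)| + 1 + 2 * |Real.log (ε / 2)| with hl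
  have hl0 : 0 ≤ l := by positivity
  have hG0 : 0 < G := by linarith
  have hT0 : 0 < T := by linarith
  have hη : 0 < 1 - γ := by linarith
  have hkk : k ≤ k ^ 2 := by nlinarith
  have hkG : G ≤ k ^ 2 * G := le_mul_of_one_le_left hG0.le (by nlinarith)
  have hkG2 : k ≤ 2 * (k ^ 2 * G) := by nlinarith
  have hinv : 1 / (1 - γ) = T * s / G := by
    rw [div_eq_div_iff hη.ne' hG0.ne']
    linarith
  have hVη : V * (1 / (1 - γ)) ≤ s * G := by
    rw [hinv, mul_div_assoc', div_le_iff₀ hG0]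
    have := mul_le_mul_of_nonneg_left hVG hs0.le
    linarith
  have hVG' : V ≤ s * G := by
    have : V ≤ V * (1 / (1 - γ)) := le_mul_of_one_le_right hV (by
      rw [le_div_iff₀ hη]; linarith)
    linarith
  -- Since `G ≥ 1/2`, the memory length `1 / (1 - γ) = T s / G` is at most `2 s T`, so its logarithm
  -- is `log T` up to a constant.
  have hβ : ε + b / (1 - γ) ≤ (ε + 2 * s * b) * T := by
    have h3 : b / (1 - γ) ≤ 2 * s * b * T := by
      rw [div_eq_mul_one_div, hinv, mul_div_assoc', div_le_iff₀ hG0]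
      have := mul_le_mul_of_nonneg_left hG (show 0 ≤ 2 * (b * (T * s)) by positivity)
      linarith
    have := le_mul_of_one_le_right hε.le hT1
    linarith
  have hlog : Real.log (ε + b / (1 - γ)) - Real.log (ε / 2) ≤ l * G := by
    have h3 : Real.log (ε + b / (1 - γ)) ≤ Real.log (ε + 2 * s * b) + Real.log T := by
      rw [← Real.log_mul (by positivity) hT0.ne']
      exact Real.log_le_log (by positivity) hβ
    have h5 : ∀ x : ℝ, x ≤ 2 * |x| * G := fun x => by
      have := le_abs_self x
      have := abs_nonneg x
      nlinarith
    have h6 := h5 (Real.log (ε + 2 * s * b))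
    have h7 := h5 (-Real.log (ε / 2))
    rw [abs_neg] at h7
    rw [hl]
    linarith
  -- `-log γ ≤ γ⁻¹ - 1 = (1 - γ) / γ`, and `γ ≥ 1/2`.
  have hlogγ : -Real.log γ ≤ 2 * (1 - γ) := by
    have hγ0 : 0 < γ := by linarith
    have h3 := Real.log_le_sub_one_of_pos (inv_pos.2 hγ0)
    rw [Real.log_inv] at h3
    have h4 : γ⁻¹ ≤ 2 := by
      rw [inv_le_comm₀ hγ0 two_pos]; linarith
    have h5 : γ⁻¹ * γ = 1 := inv_mul_cancel₀ hγ0.ne'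
    nlinarith
  have hTlog : T * (d * -Real.log γ) ≤ 2 * d / s * G := by
    have : 2 * d / s * G = T * (d * (2 * (1 - γ))) := by
      rw [← hηG]; field_simp
    rw [this]
    gcongr
  have e1 : k * ((ε + b) * F ^ 2) ≤ 2 * ((ε + b) * F ^ 2) * (k ^ 2 * G) := by
    have := mul_le_mul_of_nonneg_right hkG2 (show 0 ≤ (ε + b) * F ^ 2 by positivity)
    linarith
  have e2 : (ε + b / (1 - γ)) * (3 * F) * (c * (k ^ 2 * V))
      ≤ 3 * F * c * (ε * s + b * s) * (k ^ 2 * G) := by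
    have : (ε + b / (1 - γ)) * V ≤ (ε * s + b * s) * G := by
      have i1 := mul_le_mul_of_nonneg_left hVG' hε.le
      have i2 := mul_le_mul_of_nonneg_left hVη hb0
      rw [div_eq_mul_one_div]
      linarith
    have := mul_le_mul_of_nonneg_left this (show 0 ≤ 3 * F * c * k ^ 2 by positivity)
    linarith
  have e3 : E * (k * (d * (Real.log (ε + b / (1 - γ)) - Real.log (ε / 2)))
          - T * (d * Real.log γ)) ≤ E * (d * l + 2 * d / s) * (k ^ 2 * G) := by
    have i1 : k * (d * (Real.log (ε + b / (1 - γ)) - Real.log (ε / 2)))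
        ≤ k ^ 2 * (d * (l * G)) :=
      (mul_le_mul_of_nonneg_left (mul_le_mul_of_nonneg_left hlog hd0) (by linarith)).trans
        (mul_le_mul_of_nonneg_right hkk (by positivity))
    have i2 : 2 * d / s * G ≤ 2 * d / s * (k ^ 2 * G) :=
      mul_le_mul_of_nonneg_left hkG (by positivity)
    rw [mul_assoc E]
    refine mul_le_mul_of_nonneg_left ?_ hE0
    generalize Real.log (ε + b / (1 - γ)) - Real.log (ε / 2) = x at i1 ⊢
    generalize Real.log γ = y at hTlog ⊢
    linarith
  have e4 : E ≤ 2 * E * (k ^ 2 * G) := by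
    have := mul_le_mul_of_nonneg_left (hG.trans hkG) (show 0 ≤ 2 * E by positivity)
    linarith
  calc _ ≤ _ := add_le_add (add_le_add (add_le_add e1 e2) e3) e4
    _ = _ := by ring

/-- The cumulative `k`-step prediction error, up to a factor `k²`, is of the order of the regret
bound. -/
theorem exists_sum_prediction_error_le (n p : ℕ) (hp : 0 < p) (M D ε : ℝ) (hM : 0 < M)
    (hε : 0 < ε) :
    ∃ C : ℝ, 0 ≤ C ∧ ∀ (T W : ℕ), 2 ≤ T → ∀ (r : ℤ → Fin n → ℝ)
      (S : ℕ → Matrix (Fin n) (Fin p × Fin n) ℝ)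
      (Shat : ℕ → ℤ → Matrix (Fin n) (Fin p × Fin n) ℝ)
      (P : ℕ → ℤ → Matrix (Fin p × Fin n) (Fin p × Fin n) ℝ), IsTarget T M D r S →
      IsRLS T W M ε (forgettingFactor M T (pathLength T S)) r Shat P →
      ∀ k : ℕ, 1 ≤ k → k ≤ W → k ≤ T →
      ∑ t ∈ Finset.range (T + 1 - k), (r (t + k : ℕ) - Shat k t *ᵥ regressor p r t)
        ⬝ᵥ (r (t + k : ℕ) - Shat k t *ᵥ regressor p r t)
      ≤ C * (k ^ 2 * regretScale T (pathLength T S)) := by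
  set s := 2 * Real.sqrt M with hs
  have hs0 : 0 < s := by positivity
  set b := p * D ^ 2 with hb
  have hb0 : 0 ≤ b := by positivity
  set F := 2 * (Real.sqrt n * M) with hF
  have hF0 : 0 ≤ F := by positivity
  set c := frobNorm (outputMatrix n p) * frobNorm (outputMatrix n p)ᵀ * (p * n * (M ^ 2 + 1))
  have hc0 : 0 ≤ c := mul_nonneg (mul_nonneg (frobNorm_nonneg _) (frobNorm_nonneg _))
    (by positivity)
  set E := 4 * M ^ 2 * b with hE
  have hE0 : 0 ≤ E := by positivity
  set d : ℝ := ((p * n : ℕ) : ℝ)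
  have hd0 : 0 ≤ d := by positivity
  -- The first summand serves the case `γ < 1/2`, the rest is the constant of `tracking_terms_le`.
  refine ⟨2 * E / s + (2 * ((ε + b) * F ^ 2) + 3 * F * c * (ε * s + b * s)
    + E * (d * (2 * |Real.log (ε + 2 * s * b)| + 1 + 2 * |Real.log (ε / 2)|) + 2 * d / s)
    + 2 * E), by positivity, ?_⟩
  intro T W hT2 r S Shat P hT h k hk hkW hkT
  set V := pathLength T S
  have hV : 0 ≤ V := pathLength_nonneg T S
  set G := regretScale T V
  have hG := half_le_regretScale hT2 V
  have hG0 : 0 < G := by linarith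
  set γ := forgettingFactor M T V
  have hηG : (1 - γ) * (T * s) = G := forgettingFactor_eq hT2 hM
  have hT0 : (0 : ℝ) < T := by exact_mod_cast (by omega : 0 < T)
  have hT1 : (1 : ℝ) ≤ T := by exact_mod_cast (by omega : 1 ≤ T)
  have hη : 0 < 1 - γ := by
    rw [← hηG] at hG0
    exact pos_of_mul_pos_left hG0 (by positivity)
  have hγ1 : γ < 1 := by linarith
  have hVG : T * V ≤ G ^ 2 := mul_le_regretScale_sq hV
  have hk1 : (1 : ℝ) ≤ k := by exact_mod_cast hk
  have hkG : G ≤ k ^ 2 * G := le_mul_of_one_le_left hG0.le (by nlinarith)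
  have herr : ∀ t, t + k ≤ T → (r (t + k : ℕ) - Shat k t *ᵥ regressor p r t)
      ⬝ᵥ (r (t + k : ℕ) - Shat k t *ᵥ regressor p r t) ≤ E := fun t ht =>
    h.prediction_error_le hT hp hk hkW ht
  rw [add_mul]
  by_cases hγ : 1 / 2 ≤ γ
  · refine le_add_of_nonneg_of_le (by positivity) ?_
    have h1 : ∑ t ∈ Finset.range (T - k), (r (t + k : ℕ) - Shat k t *ᵥ regressor p r t)
        ⬝ᵥ (r (t + k : ℕ) - Shat k t *ᵥ regressor p r t)
        ≤ k * ((ε + b) * F ^ 2) + (ε + b / (1 - γ)) * (3 * F) * (c * (k ^ 2 * V))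
          + E * (k * (d * (Real.log (ε + b / (1 - γ)) - Real.log (ε / 2)))
            - T * (d * Real.log γ)) := by
      rcases hkT.lt_or_eq with hlt | heq
      · exact h.sum_prediction_error_le hT hp hM.le hε hγ hγ1 hk hkW hlt
      -- For `k = T` no learner is ever scored by an update: the sum is empty and only nonnegativity
      -- of the bound is at stake.
      · rw [heq, Nat.sub_self, Finset.sum_range_zero]
        have i1 : Real.log γ ≤ 0 := Real.log_nonpos (by linarith) hγ1.le
        have i2 : Real.log (ε / 2) ≤ Real.log (ε + b / (1 - γ)) :=
          Real.log_le_log (by positivity) (by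
            have : 0 ≤ b / (1 - γ) := by positivity
            linarith)
        have i3 : 0 ≤ T * (d * -Real.log γ) :=
          mul_nonneg hT0.le (mul_nonneg hd0 (by linarith))
        have i4 : 0 ≤ (T : ℝ) * (d * (Real.log (ε + b / (1 - γ)) - Real.log (ε / 2))) :=
          mul_nonneg hT0.le (mul_nonneg hd0 (by linarith))
        have i5 : 0 ≤ E * (T * (d * (Real.log (ε + b / (1 - γ)) - Real.log (ε / 2)))
            - T * (d * Real.log γ)) := mul_nonneg hE0 (by linarith)
        positivity
    -- The prediction of `r_T` made at time `T - k` is never used in an update, so its error is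
    -- bounded separately by `E`.
    rw [show T + 1 - k = T - k + 1 by omega, Finset.sum_range_succ]
    have h2 := herr (T - k) (by omega)
    have h3 := tracking_terms_le hε hb0 hF0 hc0 hE0 hd0 hs0 hG hT1 hV hk1 hγ hγ1 hηG hVG
      (log_le_regretScale T V)
    linarith
  -- Here `1 - γ > 1/2` forces `T ≤ (2 / s) G`, so bounding each error by `E` is enough. Neither the
  -- inverse of `P` nor the optimality of the projection enters.
  · refine le_add_of_le_of_nonneg ?_ (by positivity)
    push Not at hγ
    have hTG : T ≤ 2 / s * G := by
      rw [← hηG]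
      have : 2 / s * ((1 - γ) * (T * s)) = 2 * (1 - γ) * T := by field_simp
      rw [this]
      nlinarith
    calc _ ≤ ∑ t ∈ Finset.range (T + 1 - k), E := Finset.sum_le_sum fun t ht =>
          herr t (by have := Finset.mem_range.1 ht; omega)
      _ = ((T + 1 - k : ℕ) : ℝ) * E := by simp
      _ ≤ T * E := by
          refine mul_le_mul_of_nonneg_right ?_ hE0
          exact_mod_cast (by omega : T + 1 - k ≤ T)
      _ ≤ 2 / s * G * E := mul_le_mul_of_nonneg_right hTG hE0
      _ = 2 * E / s * G := by ring
      _ ≤ _ := mul_le_mul_of_nonneg_left hkG (by positivity)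

end Prediction

/-! ### The regret bound -/

section RegretBound

/-- The decay of the gains absorbs the quadratic growth in the number of steps of the prediction
bounds, uniformly in the horizon. -/
theorem exists_weighted_geom_sum_le {ρ : ℝ} (h0 : 0 ≤ ρ) (h1 : ρ < 1) :
    ∃ c : ℝ, 0 ≤ c ∧ ∀ W : ℕ, ∑ i ∈ Finset.range W, ρ ^ i * ((i : ℝ) + 1) ^ 2 ≤ c := by
  have hs : Summable fun i : ℕ => ρ ^ i * ((i : ℝ) + 1) ^ 2 := by
    have hn : ‖ρ‖ < 1 := by rwa [Real.norm_of_nonneg h0]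
    have h2 := summable_pow_mul_geometric_of_norm_lt_one 2 hn
    have h3 := summable_pow_mul_geometric_of_norm_lt_one 1 hn
    have h4 := summable_pow_mul_geometric_of_norm_lt_one 0 hn
    refine ((h2.add (h3.mul_left 2)).add h4).congr fun i => ?_
    ring
  exact ⟨_, tsum_nonneg fun i => by positivity, fun W =>
    hs.sum_le_tsum _ fun i _ => by positivity⟩

theorem geom_sum_le {ρ : ℝ} (h0 : 0 ≤ ρ) (h1 : ρ < 1) (N : ℕ) :
    ∑ i ∈ Finset.range N, ρ ^ i ≤ 1 / (1 - ρ) := by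
  have := (summable_geometric_of_lt_one h0 h1).sum_le_tsum (Finset.range N)
    fun i _ => pow_nonneg h0 i
  rwa [tsum_geometric_of_lt_one h0 h1, ← one_div] at this

/-- Cauchy–Schwarz splitting the weight as `ρ ^ i · ρ ^ i`, so that a factor `ρ ^ i` still discounts
each squared error. -/
theorem sq_sum_geom_le {ρ : ℝ} (h0 : 0 ≤ ρ) (h1 : ρ < 1) (N : ℕ) (φ : ℕ → ℝ) :
    (∑ i ∈ Finset.range N, ρ ^ i * φ i) ^ 2
      ≤ 1 / (1 - ρ) * ∑ i ∈ Finset.range N, ρ ^ i * φ i ^ 2 := by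
  refine (Finset.sum_sq_le_sum_mul_sum_of_sq_le_mul (Finset.range N) (f := fun i => ρ ^ i)
    (g := fun i => ρ ^ i * φ i ^ 2) (fun i _ => pow_nonneg h0 i) (fun i _ => by positivity)
    fun i _ => le_of_eq (by ring)).trans ?_
  exact mul_le_mul_of_nonneg_right (geom_sum_le h0 h1 N)
    (Finset.sum_nonneg fun i _ => by positivity)

/-- Sum of squares of geometrically discounted errors. -/
theorem sum_sq_discounted_le {ρ κ c w H : ℝ} (h0 : 0 ≤ ρ) (h1 : ρ < 1)
    (hκ : ∀ W : ℕ, ∑ i ∈ Finset.range W, ρ ^ i * ((i : ℝ) + 1) ^ 2 ≤ κ) (hH : 0 ≤ H)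
    {T W : ℕ} {φ : ℕ → ℕ → ℝ} {δ : ℕ → ℝ} (hδ0 : ∀ t, 0 ≤ δ t)
    (hφ : ∀ i < W, ∑ t ∈ Finset.range T, φ t i ^ 2 ≤ H * ((i : ℝ) + 1) ^ 2)
    (hδ : ∀ t < T, δ t ≤ c * (∑ i ∈ Finset.range W, ρ ^ i * φ t i + w * (ρ ^ W / (1 - ρ))
      + w * ρ ^ (T - t))) :
    ∑ t ∈ Finset.range T, δ t ^ 2 ≤ 3 * c ^ 2 * (1 / (1 - ρ) * (H * κ)
      + w ^ 2 * (T * (ρ ^ W) ^ 2 / (1 - ρ) ^ 2) + w ^ 2 * (1 / (1 - ρ))) := by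
  have hρ : 0 < 1 - ρ := by linarith
  have hstep : ∀ t ∈ Finset.range T, δ t ^ 2 ≤ 3 * c ^ 2 *
      (1 / (1 - ρ) * ∑ i ∈ Finset.range W, ρ ^ i * φ t i ^ 2
        + w ^ 2 * ((ρ ^ W) ^ 2 / (1 - ρ) ^ 2) + w ^ 2 * ρ ^ (T - t)) := by
    intro t ht
    have h2 := pow_le_pow_left₀ (hδ0 t) (hδ t (Finset.mem_range.1 ht)) 2
    have h3 := sq_sum_geom_le h0 h1 W (φ t)
    have h4 : (ρ ^ (T - t)) ^ 2 ≤ ρ ^ (T - t) := by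
      rw [sq]
      exact mul_le_of_le_one_left (pow_nonneg h0 _) (pow_le_one₀ h0 h1.le)
    set a := ∑ i ∈ Finset.range W, ρ ^ i * φ t i
    have h5 : (a + w * (ρ ^ W / (1 - ρ)) + w * ρ ^ (T - t)) ^ 2
        ≤ 3 * (a ^ 2 + (w * (ρ ^ W / (1 - ρ))) ^ 2 + (w * ρ ^ (T - t)) ^ 2) := by
      generalize w * (ρ ^ W / (1 - ρ)) = b
      generalize w * ρ ^ (T - t) = d
      nlinarith [sq_nonneg (a - b), sq_nonneg (a - d), sq_nonneg (b - d)]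
    rw [mul_pow] at h2
    refine h2.trans ?_
    rw [mul_comm 3, mul_assoc]
    refine mul_le_mul_of_nonneg_left (h5.trans ?_) (sq_nonneg c)
    rw [mul_pow w, mul_pow w, div_pow]
    have h6 := mul_le_mul_of_nonneg_left h4 (sq_nonneg w)
    linarith
  refine (Finset.sum_le_sum hstep).trans ?_
  rw [← Finset.mul_sum, Finset.sum_add_distrib, Finset.sum_add_distrib, ← Finset.mul_sum,
    ← Finset.mul_sum (a := w ^ 2) (f := fun t => ρ ^ (T - t)), Finset.sum_comm]
  -- After exchanging the sums, time is summed first, since the prediction bounds are cumulative in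
  -- time for each fixed number of steps.
  have e1 : ∑ i ∈ Finset.range W, ∑ t ∈ Finset.range T, ρ ^ i * φ t i ^ 2 ≤ H * κ := by
    calc _ ≤ ∑ i ∈ Finset.range W, H * (ρ ^ i * ((i : ℝ) + 1) ^ 2) := by
          refine Finset.sum_le_sum fun i hi => ?_
          rw [← Finset.mul_sum]
          have := mul_le_mul_of_nonneg_left (hφ i (Finset.mem_range.1 hi)) (pow_nonneg h0 i)
          linarith
      _ ≤ H * κ := by
          rw [← Finset.mul_sum]
          exact mul_le_mul_of_nonneg_left (hκ W) hH
  have e2 : ∑ t ∈ Finset.range T, ρ ^ (T - t) ≤ 1 / (1 - ρ) := by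
    calc _ ≤ ∑ t ∈ Finset.range T, ρ ^ (T - 1 - t) := Finset.sum_le_sum fun t _ =>
          pow_le_pow_of_le_one h0 h1.le (by omega)
      _ = ∑ t ∈ Finset.range T, ρ ^ t := Finset.sum_range_reflect (fun i => ρ ^ i) T
      _ ≤ _ := geom_sum_le h0 h1 T
  have e3 : ∑ _t ∈ Finset.range T, w ^ 2 * ((ρ ^ W) ^ 2 / (1 - ρ) ^ 2)
      = w ^ 2 * (T * (ρ ^ W) ^ 2 / (1 - ρ) ^ 2) := by
    simp only [Finset.sum_const, Finset.card_range, nsmul_eq_mul]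
    ring
  rw [e3]
  gcongr

variable {n m p : ℕ} {A : Matrix (Fin n) (Fin n) ℝ} {B : Matrix (Fin n) (Fin m) ℝ}
  {Q : Matrix (Fin n) (Fin n) ℝ} {R : Matrix (Fin m) (Fin m) ℝ} {X : Matrix (Fin n) (Fin n) ℝ}
  {T W N : ℕ} {M D ε γ ρ c : ℝ} {r : ℤ → Fin n → ℝ}
  {S : ℕ → Matrix (Fin n) (Fin p × Fin n) ℝ}
  {Shat : ℕ → ℤ → Matrix (Fin n) (Fin p × Fin n) ℝ}
  {P : ℕ → ℤ → Matrix (Fin p × Fin n) (Fin p × Fin n) ℝ}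

/-- The error of the `k`-step prediction made at time `t`. -/
def predictionError (T : ℕ) (r : ℤ → Fin n → ℝ)
    (Shat : ℕ → ℤ → Matrix (Fin n) (Fin p × Fin n) ℝ) (t k : ℕ) : ℝ :=
  euclNorm (r (t + k : ℕ) - prediction T r Shat t k)

theorem predictionError_zero (t : ℕ) : predictionError T r Shat t 0 = 0 := by
  simp [predictionError, prediction, euclNorm_zero]

theorem predictionError_sq {t k : ℕ} (hk : 1 ≤ k) (htk : t + k ≤ T) :
    predictionError T r Shat t k ^ 2 = (r (t + k : ℕ) - Shat k t *ᵥ regressor p r t)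
        ⬝ᵥ (r (t + k : ℕ) - Shat k t *ᵥ regressor p r t) := by
  rw [predictionError, euclNorm_sq, prediction, if_neg (by omega), if_pos htk]

/-- The one-step disturbance error `‖A‖ ‖r_{t+i} - r_{t+i|t}‖ + ‖r_{t+i+1} - r_{t+i+1|t}‖` within
the horizon. -/
def disturbanceError (A : Matrix (Fin n) (Fin n) ℝ) (T : ℕ) (r : ℤ → Fin n → ℝ)
    (Shat : ℕ → ℤ → Matrix (Fin n) (Fin p × Fin n) ℝ) (t i : ℕ) : ℝ :=
  if t + i < T then specNorm A * predictionError T r Shat t i + predictionError T r Shat t (i + 1)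
  else 0

/-- Both the `i`- and the `(i + 1)`-step errors obey the bound for `i + 1` steps; for `i = 0` the
current target is observed and the first error vanishes. -/
theorem sum_disturbanceError_sq_le {G C : ℝ} (hC : 0 ≤ C) (hG : 0 ≤ G)
    (h : ∀ k : ℕ, 1 ≤ k → k ≤ W → k ≤ T →
      ∑ t ∈ Finset.range (T + 1 - k), (r (t + k : ℕ) - Shat k t *ᵥ regressor p r t)
        ⬝ᵥ (r (t + k : ℕ) - Shat k t *ᵥ regressor p r t) ≤ C * (k ^ 2 * G)) {i : ℕ}
    (hi : i < W) : ∑ t ∈ Finset.range T, disturbanceError A T r Shat t i ^ 2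
      ≤ 2 * (specNorm A ^ 2 + 1) * (C * G) * ((i : ℝ) + 1) ^ 2 := by
  by_cases hiT : T ≤ i
  · rw [Finset.sum_eq_zero fun t _ => by rw [disturbanceError, if_neg (by omega)]; simp]
    positivity
  push Not at hiT
  have h1 : ∑ t ∈ Finset.range T, disturbanceError A T r Shat t i ^ 2
      = ∑ t ∈ Finset.range (T - i), disturbanceError A T r Shat t i ^ 2 := by
    refine (Finset.sum_subset (Finset.range_mono (Nat.sub_le T i)) fun t _ ht => ?_).symm
    rw [disturbanceError, if_neg (by rw [Finset.mem_range] at ht; omega)]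
    simp
  have h2 : ∀ k, 1 ≤ k → k ≤ W → k ≤ T → ∑ t ∈ Finset.range (T + 1 - k),
      predictionError T r Shat t k ^ 2 ≤ C * (k ^ 2 * G) := by
    intro k hk hkW hkT
    refine le_trans (le_of_eq (Finset.sum_congr rfl fun t ht => ?_)) (h k hk hkW hkT)
    exact predictionError_sq hk (by have := Finset.mem_range.1 ht; omega)
  have h3 : ∑ t ∈ Finset.range (T - i), predictionError T r Shat t i ^ 2
      ≤ C * (((i : ℝ) + 1) ^ 2 * G) := by
    rcases Nat.eq_zero_or_pos i with rfl | hpos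
    · rw [Finset.sum_eq_zero fun t _ => by rw [predictionError_zero]; simp]
      positivity
    · refine (Finset.sum_le_sum_of_subset_of_nonneg (Finset.range_mono (by omega))
        fun _ _ _ => sq_nonneg _).trans ((h2 i hpos (by omega) (by omega)).trans ?_)
      gcongr
      linarith
  have h4 := h2 (i + 1) (by omega) (by omega) (by omega)
  rw [show T + 1 - (i + 1) = T - i by omega] at h4
  push_cast at h4
  rw [h1]
  calc _ ≤ ∑ t ∈ Finset.range (T - i), (2 * specNorm A ^ 2 * predictionError T r Shat t i ^ 2
          + 2 * predictionError T r Shat t (i + 1) ^ 2) := by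
        refine Finset.sum_le_sum fun t ht => ?_
        rw [disturbanceError, if_pos (by have := Finset.mem_range.1 ht; omega)]
        nlinarith [sq_nonneg (specNorm A * predictionError T r Shat t i
          - predictionError T r Shat t (i + 1))]
    _ ≤ _ := by
        rw [Finset.sum_add_distrib, ← Finset.mul_sum, ← Finset.mul_sum]
        have := mul_le_mul_of_nonneg_left h3 (show 0 ≤ 2 * specNorm A ^ 2 by positivity)
        linarith

theorem euclNorm_prediction_le (hT : IsTarget T M D r S) (h : IsRLS T W M ε γ r Shat P)
    (hM : 0 ≤ M) {t k : ℕ} (hk : 1 ≤ k) (hkW : k ≤ W) (htk : t + k ≤ T) :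
    euclNorm (prediction T r Shat t k) ≤ M * Real.sqrt (p * D ^ 2) := by
  rw [prediction, if_neg (by omega), if_pos htk]
  refine (euclNorm_mulVec_le _ _).trans (mul_le_mul (h.mem hk hkW (by omega)) ?_
    (euclNorm_nonneg _) hM)
  refine Real.le_sqrt_of_sq_le ?_
  rw [euclNorm_sq]
  exact euclNorm_regressor_sq_le hT t (by omega)

/-- The feedforward term of the oracle, extended by zero beyond the horizon. -/
def oracleTerm (A : Matrix (Fin n) (Fin n) ℝ) (B : Matrix (Fin n) (Fin m) ℝ)
    (R : Matrix (Fin m) (Fin m) ℝ) (X : Matrix (Fin n) (Fin n) ℝ) (T : ℕ) (r : ℤ → Fin n → ℝ)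
    (t i : ℕ) : Fin m → ℝ :=
  if t + i < T then ffGain A B R X i *ᵥ disturbance A r (t + i) else 0

/-- The feedforward term of PLOT, extended by zero beyond the prediction horizon. -/
def plotTerm (A : Matrix (Fin n) (Fin n) ℝ) (B : Matrix (Fin n) (Fin m) ℝ)
    (R : Matrix (Fin m) (Fin m) ℝ) (X : Matrix (Fin n) (Fin n) ℝ) (T W N : ℕ)
    (r : ℤ → Fin n → ℝ) (Shat : ℕ → ℤ → Matrix (Fin n) (Fin p × Fin n) ℝ) (t i : ℕ) :
    Fin m → ℝ :=
  if i < W ∧ t + i ≤ N then ffGain A B R X i *ᵥ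
    (A *ᵥ prediction T r Shat t i - prediction T r Shat t (i + 1)) else 0

/-- Both actions are taken in the same state, so the feedback cancels; padding with zeros puts the
two feedforward sums on a common range. -/
theorem plotAction_sub_oracleInput (t : ℕ) (x : Fin n → ℝ) :
    plotAction A B R X T W N r Shat t x - oracleInput A B R X T r t x
      = ∑ i ∈ Finset.range (W + T),
        (oracleTerm A B R X T r t i - plotTerm A B R X T W N r Shat t i) := by
  have h1 : ∑ i ∈ Finset.range (W + T), oracleTerm A B R X T r t i
      = ∑ i ∈ Finset.range (T - t), ffGain A B R X i *ᵥ disturbance A r (t + i) := by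
    simp only [oracleTerm]
    rw [← Finset.sum_filter]
    refine Finset.sum_congr ?_ fun _ _ => rfl
    ext i
    simp only [Finset.mem_filter, Finset.mem_range]
    omega
  have h2 : ∑ i ∈ Finset.range (W + T), plotTerm A B R X T W N r Shat t i
      = ∑ i ∈ (Finset.range W).filter (fun i => t + i ≤ N), ffGain A B R X i *ᵥ
          (A *ᵥ prediction T r Shat t i - prediction T r Shat t (i + 1)) := by
    simp only [plotTerm]
    rw [← Finset.sum_filter]
    refine Finset.sum_congr ?_ fun _ _ => rfl
    ext i
    simp only [Finset.mem_filter, Finset.mem_range]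
    omega
  rw [Finset.sum_sub_distrib, h1, h2, plotAction, oracleInput]
  abel

/-- A bound on the exact and on the predicted disturbances. -/
def disturbanceBound (A : Matrix (Fin n) (Fin n) ℝ) (p : ℕ) (M D : ℝ) : ℝ :=
  specNorm A * |D| + |D| + specNorm A * (M * Real.sqrt (p * D ^ 2))

theorem disturbanceBound_nonneg (hM : 0 ≤ M) : 0 ≤ disturbanceBound A p M D := by
  have := specNorm_nonneg A
  rw [disturbanceBound]
  positivity

theorem euclNorm_disturbance_le (hT : IsTarget T M D r S) {t : ℕ} (ht : t < T) :
    euclNorm (disturbance A r t) ≤ specNorm A * |D| + |D| := by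
  refine (euclNorm_sub_le _ _).trans (add_le_add ((euclNorm_mulVec_le _ _).trans
    (mul_le_mul_of_nonneg_left ?_ (specNorm_nonneg A))) ?_)
  · exact (hT.bounded t (by omega)).trans (le_abs_self D)
  · exact (hT.bounded (t + 1) (by omega)).trans (le_abs_self D)

/-- The three indicators separate prediction error inside the horizon, truncation by `W`, and the
extra term at `i = T - t` that PLOT may apply when `N = T`. -/
theorem euclNorm_term_sub_le (hT : IsTarget T M D r S) (h : IsRLS T W M ε γ r Shat P)
    (hM : 0 ≤ M) (hN : N = T - 1 ∨ N = T) (hρ : 0 ≤ ρ) (hc : 0 ≤ c)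
    (hK : ∀ i, specNorm (ffGain A B R X i) ≤ c * ρ ^ i) {t : ℕ} (ht : t < T) (i : ℕ) :
    euclNorm (oracleTerm A B R X T r t i - plotTerm A B R X T W N r Shat t i)
      ≤ c * ((if i < W then ρ ^ i * disturbanceError A T r Shat t i else 0)
        + (if W ≤ i then disturbanceBound A p M D * ρ ^ i else 0)
        + (if i = T - t then disturbanceBound A p M D * ρ ^ i else 0)) := by
  have hw := disturbanceBound_nonneg (A := A) (p := p) (D := D) hM
  have hb : ∀ v, ∀ b, euclNorm v ≤ b → euclNorm (ffGain A B R X i *ᵥ v) ≤ c * (ρ ^ i * b) := by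
    intro v b hv
    rw [← mul_assoc]
    exact (euclNorm_mulVec_le _ _).trans
      (mul_le_mul (hK i) hv (euclNorm_nonneg _) (by positivity))
  have hsA := specNorm_nonneg A
  have hT' : (if i = T - t then disturbanceBound A p M D * ρ ^ i else 0) ≥ 0 := by
    split_ifs <;> positivity
  by_cases hiW : i < W
  · rw [if_pos hiW, if_neg (by omega), add_zero]
    by_cases hit : t + i < T
    · rw [oracleTerm, if_pos hit, plotTerm, if_pos ⟨hiW, by omega⟩, ← Matrix.mulVec_sub]
      have h1 : disturbance A r (t + i)
          - (A *ᵥ prediction T r Shat t i - prediction T r Shat t (i + 1))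
          = A *ᵥ (r (t + i : ℕ) - prediction T r Shat t i)
            - (r (t + (i + 1) : ℕ) - prediction T r Shat t (i + 1)) := by
        rw [disturbance, Matrix.mulVec_sub, show ((t + i : ℕ) : ℤ) + 1 = (t + (i + 1) : ℕ) by
          push_cast; ring]
        abel
      have h2 : euclNorm (disturbance A r (t + i)
          - (A *ᵥ prediction T r Shat t i - prediction T r Shat t (i + 1)))
          ≤ disturbanceError A T r Shat t i := by
        rw [h1, disturbanceError, if_pos hit]
        exact (euclNorm_sub_le _ _).trans (add_le_add (euclNorm_mulVec_le _ _) le_rfl)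
      refine (hb _ _ h2).trans (mul_le_mul_of_nonneg_left ?_ hc)
      linarith
    · have h0 : disturbanceError A T r Shat t i = 0 := by rw [disturbanceError, if_neg hit]
      rw [oracleTerm, if_neg hit, h0, mul_zero, zero_add]
      by_cases hiN : t + i ≤ N
      · have hi : i = T - t := by omega
        rw [plotTerm, if_pos ⟨hiW, hiN⟩, if_pos hi, euclNorm_sub_comm, sub_zero, mul_comm _ (ρ ^ i)]
        refine hb _ _ ?_
        have h1 : prediction T r Shat t (i + 1) = 0 := by
          rw [prediction, if_neg (by omega), if_neg (by omega)]
        rw [h1, sub_zero]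
        refine (euclNorm_mulVec_le _ _).trans ?_
        have h2 := mul_le_mul_of_nonneg_left
          (euclNorm_prediction_le hT h hM (t := t) (k := i) (by omega) hiW.le (by omega)) hsA
        have h3 : 0 ≤ specNorm A * |D| + |D| := by positivity
        rw [disturbanceBound]
        linarith
      · rw [plotTerm, if_neg (by omega), sub_zero, euclNorm_zero]
        exact mul_nonneg hc hT'
  · rw [if_neg hiW, if_pos (by omega), plotTerm, if_neg (by omega), sub_zero, zero_add]
    by_cases hit : t + i < T
    · rw [oracleTerm, if_pos hit]
      have h1 : euclNorm (disturbance A r (t + i)) ≤ disturbanceBound A p M D := by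
        have h2 : 0 ≤ specNorm A * (M * Real.sqrt (p * D ^ 2)) := by positivity
        have h3 := euclNorm_disturbance_le (A := A) hT hit
        rw [disturbanceBound]
        linarith
      refine (hb _ _ h1).trans (mul_le_mul_of_nonneg_left ?_ hc)
      linarith
    · rw [oracleTerm, if_neg hit, euclNorm_zero]
      positivity

theorem euclNorm_plotAction_sub_le (hT : IsTarget T M D r S) (h : IsRLS T W M ε γ r Shat P)
    (hM : 0 ≤ M) (hN : N = T - 1 ∨ N = T) (hρ : 0 ≤ ρ) (hρ1 : ρ < 1) (hc : 0 ≤ c)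
    (hK : ∀ i, specNorm (ffGain A B R X i) ≤ c * ρ ^ i) {t : ℕ} (ht : t < T) (x : Fin n → ℝ) :
    euclNorm (plotAction A B R X T W N r Shat t x - oracleInput A B R X T r t x)
      ≤ c * (∑ i ∈ Finset.range W, ρ ^ i * disturbanceError A T r Shat t i
        + disturbanceBound A p M D * (ρ ^ W / (1 - ρ))
        + disturbanceBound A p M D * ρ ^ (T - t)) := by
  have hw := disturbanceBound_nonneg (A := A) (p := p) (D := D) hM
  rw [plotAction_sub_oracleInput]
  refine (euclNorm_sum_le _ _).trans ((Finset.sum_le_sum fun i _ =>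
    euclNorm_term_sub_le hT h hM hN hρ hc hK ht i).trans ?_)
  rw [← Finset.mul_sum, Finset.sum_add_distrib, Finset.sum_add_distrib]
  refine mul_le_mul_of_nonneg_left (add_le_add (add_le_add ?_ ?_) ?_) hc
  · rw [← Finset.sum_filter]
    refine le_of_eq (Finset.sum_congr ?_ fun _ _ => rfl)
    ext i
    simp only [Finset.mem_filter, Finset.mem_range]
    omega
  · rw [← Finset.sum_filter, ← Finset.mul_sum]
    refine mul_le_mul_of_nonneg_left ?_ hw
    have h1 : (Finset.range (W + T)).filter (fun i => W ≤ i) = Finset.Ico W (W + T) := by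
      ext i
      simp only [Finset.mem_filter, Finset.mem_range, Finset.mem_Ico]
      omega
    rw [h1, Finset.sum_Ico_eq_sum_range]
    simp only [pow_add]
    rw [← Finset.mul_sum, div_eq_mul_one_div]
    exact mul_le_mul_of_nonneg_left (geom_sum_le hρ hρ1 _) (pow_nonneg hρ W)
  · rw [Finset.sum_ite_eq' (Finset.range (W + T)) (T - t)]
    split_ifs
    · exact le_rfl
    · positivity

/-- The prediction horizon is long enough for the truncation error to be summable. -/
theorem horizon_mul_decay_le (hρ : 0 < ρ) (hρ1 : ρ < 1) (hT : 0 < T)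
    (hW : |(W : ℝ) - -Real.log T / (2 * Real.log ρ)| < 1) : T * (ρ ^ W) ^ 2 ≤ 1 / ρ ^ 2 := by
  have hT0 : (0 : ℝ) < T := by exact_mod_cast hT
  have hl : Real.log ρ < 0 := Real.log_neg hρ hρ1
  have h1 := (abs_lt.1 hW).1
  have h2 : -Real.log T / (2 * Real.log ρ) * (2 * Real.log ρ) = -Real.log T :=
    div_mul_cancel₀ _ (by linarith)
  set x := -Real.log T / (2 * Real.log ρ)
  -- Rounding down loses less than one step, so `T ρ ^ (2 (W + 1)) ≤ 1`; the missing step is paid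
  -- for by `1 / ρ ^ 2`.
  have h3 : ((W : ℝ) + 1) * (2 * Real.log ρ) ≤ -Real.log T := by
    rw [← h2]
    exact mul_le_mul_of_nonpos_right (by linarith) (by linarith)
  have h4 : Real.log (T * (ρ ^ (W + 1)) ^ 2) ≤ 0 := by
    rw [Real.log_mul hT0.ne' (by positivity), Real.log_pow, Real.log_pow]
    push_cast
    linarith
  rw [Real.log_nonpos_iff (by positivity)] at h4
  rw [le_div_iff₀ (by positivity)]
  calc _ = T * (ρ ^ (W + 1)) ^ 2 := by ring
    _ ≤ 1 := h4

theorem exists_dynamicRegret_le [NeZero n] (hp : 0 < p) (hQ : Q.PosDef) (hR : R.PosDef)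
    (hX : IsRiccatiSolution A B Q R X) (hρ : 0 < decayRate Q X) (hM : 0 < M) (hε : 0 < ε) (D : ℝ) :
    ∃ C : ℝ, ∀ (T : ℕ), 2 ≤ T →
      ∀ (r : ℤ → Fin n → ℝ) (S : ℕ → Matrix (Fin n) (Fin p × Fin n) ℝ),
        IsTarget T M D r S →
      ∀ (W : ℕ), |(W : ℝ) - -Real.log T / (2 * Real.log (decayRate Q X))| < 1 →
      ∀ (N : ℕ), (N = T - 1 ∨ N = T) →
      ∀ (x₀ : Fin n → ℝ) (u : ℕ → Fin m → ℝ),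
        IsPLOTInput A B R X p T W N M ε (forgettingFactor M T (pathLength T S)) r x₀ u →
        dynamicRegret A B Q R X T r x₀ u ≤ C * regretScale T (pathLength T S) := by
  have hρ1 := decayRate_lt_one hQ (riccati_posDef hQ hR hX)
  set ρ := decayRate Q X with hρdef
  obtain ⟨C, hC0, hC⟩ := exists_sum_prediction_error_le n p hp M D ε hM hε
  obtain ⟨c, hc0, hc⟩ := exists_specNorm_ffGain_le hQ hR hX hρ
  obtain ⟨κ, hκ0, hκ⟩ := exists_weighted_geom_sum_le hρ.le hρ1
  set w := disturbanceBound A p M D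
  set a := 2 * (specNorm A ^ 2 + 1)
  have ha : 0 ≤ a := by positivity
  have h1ρ : 0 < 1 - ρ := by linarith
  -- The truncation and boundary terms do not scale with `G`; their factor `2` comes from `1 ≤ 2 G`.
  -- The absolute value avoids discussing the sign of `maxEig`, which is `0` for an empty input
  -- space.
  refine ⟨|maxEig (inputWeight B R X)| * (3 * c ^ 2 * (1 / (1 - ρ) * (a * C * κ)
    + 2 * (w ^ 2 * (1 / ρ ^ 2 / (1 - ρ) ^ 2) + w ^ 2 * (1 / (1 - ρ))))), ?_⟩
  intro T hT2 r S hT W hW N hN x₀ u ⟨Shat, P, hRLS, hu⟩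
  set G := regretScale T (pathLength T S)
  have hG := half_le_regretScale hT2 (pathLength T S)
  have hG0 : 0 ≤ G := by linarith
  have hpred := hC T W hT2 r S Shat P hT hRLS
  have key := sum_sq_discounted_le (c := c) (w := w) (H := a * (C * G)) hρ.le hρ1 hκ
    (by positivity) (T := T) (W := W) (φ := disturbanceError A T r Shat)
    (δ := fun t => euclNorm (u t - oracleInput A B R X T r t (stateTraj A B x₀ u t)))
    (fun t => euclNorm_nonneg _)
    (fun i hi => sum_disturbanceError_sq_le hC0 hG0 hpred hi)
    (fun t ht => by
      simp only [hu t ht]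
      exact euclNorm_plotAction_sub_le hT hRLS hM.le hN hρ.le hρ1 hc0 hc ht _)
  have hhor := horizon_mul_decay_le hρ hρ1 (by omega) hW
  refine (dynamicRegret_le hR hX T r x₀ u).trans ?_
  have hsum0 : 0 ≤ ∑ t ∈ Finset.range T,
      euclNorm (u t - oracleInput A B R X T r t (stateTraj A B x₀ u t)) ^ 2 :=
    Finset.sum_nonneg fun _ _ => sq_nonneg _
  refine (mul_le_mul_of_nonneg_right (le_abs_self _) hsum0).trans ?_
  rw [mul_assoc]
  refine mul_le_mul_of_nonneg_left (key.trans ?_) (abs_nonneg _)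
  rw [mul_assoc (3 * c ^ 2)]
  refine mul_le_mul_of_nonneg_left ?_ (by positivity)
  set b := w ^ 2 * (1 / ρ ^ 2 / (1 - ρ) ^ 2) + w ^ 2 * (1 / (1 - ρ)) with hb
  have hb0 : 0 ≤ b := by positivity
  have h1 : w ^ 2 * (T * (ρ ^ W) ^ 2 / (1 - ρ) ^ 2) ≤ w ^ 2 * (1 / ρ ^ 2 / (1 - ρ) ^ 2) := by
    gcongr
  have h2 : b ≤ 2 * b * G := by
    have := mul_le_mul_of_nonneg_left hG (show 0 ≤ 2 * b by positivity)
    linarith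
  linarith

/-- With an empty state space the spectra are empty and the decay rate takes the junk value `1`, so
the general argument breaks down. But then PLOT and the oracle both apply the zero input. -/
theorem dynamicRegret_le_zero_of_dim_zero {A : Matrix (Fin 0) (Fin 0) ℝ}
    {B : Matrix (Fin 0) (Fin m) ℝ} {Q X : Matrix (Fin 0) (Fin 0) ℝ} {r : ℤ → Fin 0 → ℝ}
    (hR : R.PosDef) (hX : IsRiccatiSolution A B Q R X) {x₀ : Fin 0 → ℝ} {u : ℕ → Fin m → ℝ}
    (hu : IsPLOTInput A B R X p T W N M ε γ r x₀ u) : dynamicRegret A B Q R X T r x₀ u ≤ 0 := by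
  obtain ⟨Shat, P, -, hu⟩ := hu
  have hK : ∀ (K : Matrix (Fin m) (Fin 0) ℝ) (v : Fin 0 → ℝ), K *ᵥ v = 0 := fun K v => by
    ext i
    simp [Matrix.mulVec, dotProduct]
  refine (dynamicRegret_le hR hX T r x₀ u).trans (le_of_eq ?_)
  rw [Finset.sum_eq_zero, mul_zero]
  intro t ht
  rw [hu t (Finset.mem_range.1 ht)]
  simp [plotAction, oracleInput, hK, euclNorm_zero]

end RegretBound

end PLOT

end

theorem mainTheorem2 (n m p : ℕ) (hp : 0 < p)
    (A : Matrix (Fin n) (Fin n) ℝ) (B : Matrix (Fin n) (Fin m) ℝ)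
    (Q : Matrix (Fin n) (Fin n) ℝ) (R : Matrix (Fin m) (Fin m) ℝ)
    (X : Matrix (Fin n) (Fin n) ℝ)
    (hAB : PLOT.IsStabilizable A B) (hQ : Q.PosDef) (hR : R.PosDef)
    (hX : PLOT.IsRiccatiSolution A B Q R X)
    (hρ : 0 < PLOT.decayRate Q X)
    (M D ε : ℝ) (hM : 0 < M) (hε : 0 < ε) :
    ∃ C : ℝ, ∀ (T : ℕ), 2 ≤ T →
      ∀ (r : ℤ → Fin n → ℝ) (S : ℕ → Matrix (Fin n) (Fin p × Fin n) ℝ),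
        PLOT.IsTarget T M D r S →
      ∀ (W : ℕ), |(W : ℝ) - -Real.log T / (2 * Real.log (PLOT.decayRate Q X))| < 1 →
      ∀ (N : ℕ), (N = T - 1 ∨ N = T) →
      ∀ (x₀ : Fin n → ℝ) (u : ℕ → Fin m → ℝ),
        PLOT.IsPLOTInput A B R X p T W N M ε
          (PLOT.forgettingFactor M T (PLOT.pathLength T S)) r x₀ u →
        PLOT.dynamicRegret A B Q R X T r x₀ u
            ≤ C * max (Real.sqrt (T * PLOT.pathLength T S)) (Real.log T) ∧
        (PLOT.pathLength T S = 0 →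
          PLOT.dynamicRegret A B Q R X T r x₀ u ≤ C * Real.log T) := by
  have hmain : ∃ C : ℝ, ∀ (T : ℕ), 2 ≤ T →
      ∀ (r : ℤ → Fin n → ℝ) (S : ℕ → Matrix (Fin n) (Fin p × Fin n) ℝ),
        PLOT.IsTarget T M D r S →
      ∀ (W : ℕ), |(W : ℝ) - -Real.log T / (2 * Real.log (PLOT.decayRate Q X))| < 1 →
      ∀ (N : ℕ), (N = T - 1 ∨ N = T) →
      ∀ (x₀ : Fin n → ℝ) (u : ℕ → Fin m → ℝ),
        PLOT.IsPLOTInput A B R X p T W N M ε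
          (PLOT.forgettingFactor M T (PLOT.pathLength T S)) r x₀ u →
        PLOT.dynamicRegret A B Q R X T r x₀ u
          ≤ C * PLOT.regretScale T (PLOT.pathLength T S) := by
    rcases n with _ | n
    · refine ⟨0, fun T _ r S _ W _ N _ x₀ u hu => ?_⟩
      rw [zero_mul]
      exact PLOT.dynamicRegret_le_zero_of_dim_zero hR hX hu
    · exact PLOT.exists_dynamicRegret_le hp hQ hR hX hρ hM hε D
  obtain ⟨C, hC⟩ := hmain
  refine ⟨C, fun T hT r S hS W hW N hN x₀ u hu => ?_⟩
  have h := hC T hT r S hS W hW N hN x₀ u hu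
  refine ⟨h, fun hV => ?_⟩
  have hlog : 0 ≤ Real.log T := Real.log_nonneg (by exact_mod_cast (by omega : 1 ≤ T))
  rwa [PLOT.regretScale, hV, mul_zero, Real.sqrt_zero, max_eq_right hlog] at h
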